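/- There is an algorithm that, given an $n$-vertex hypergraph $H$ of rank at most $4$ (that is, a finite set $V$ of $n$ vertices and a set of subsets of $V$, the hyperedges, each of size at most $4$; this includes all hypergraphs of rank exactly $4$), enumerates all minimal transversals of $H$, each exactly once, in time $O(1.8863^n)$. (A transversal is a set $S\subseteq V$ that meets every hyperedge; it is minimal if no proper subset of $S$ is a transversal.) Consequently, the number of minimal transversals of an $n$-vertex hypergraph of rank at most $4$ is $O(1.8863^n)$. -/

import Mathlib

open Asymptotics Filter

/-! ## Transversals of hypergraphs -/

namespace Hypergraph

/-- A transversal of `H` is a set of vertices that meets every hyperedge. -/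
def IsTransversal {α : Type*} (H : Hypergraph α) (S : Set α) : Prop :=
  S ⊆ H.vertexSet ∧ ∀ e ∈ H.edgeSet, (S ∩ e).Nonempty

/-- A transversal is minimal if no proper subset of it is a transversal. -/
def IsMinimalTransversal {α : Type*} (H : Hypergraph α) (S : Set α) : Prop :=
  Minimal H.IsTransversal S

/-- The rank of a hypergraph: the maximum size of a hyperedge. -/
noncomputable def rank {α : Type*} (H : Hypergraph α) : ℕ∞ :=
  ⨆ e ∈ H.edgeSet, e.encard

end Hypergraph

/-! ## The machine model

While-programs over binary trees (Lisp cells), with an explicit step count. A program has finitely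
many variables, each of which holds a (pointer to a) tree. Reading a variable, allocating a cell,
following one of the two pointers of a cell and testing for `nil` take one step each, which is what
they cost on a random access machine, up to a constant factor. Trees are written to a write-only
output stream, and writing one takes as many steps as the tree has nodes. There is no arithmetic, so
no unit-cost operation on large numbers. -/

namespace TreeMachine

/-- The data of the machine: binary trees. -/
inductive Data : Type
  | nil : Data
  | cons : Data → Data → Data

namespace Data

/-- The left component (`nil` for `nil`). -/
def fst : Data → Data
  | nil => nil
  | cons a _ => a

/-- The right component (`nil` for `nil`). -/
def snd : Data → Data
  | nil => nil
  | cons _ b => b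

/-- The number of nodes of a tree. -/
def size : Data → ℕ
  | nil => 1
  | cons a b => a.size + b.size + 1

/-- A list of trees as a tree. -/
def ofList : List Data → Data
  | [] => nil
  | a :: l => cons a (ofList l)

/-- The truth value of a proposition as a tree: `nil` for false, a single cell for true. -/
noncomputable def ofProp (P : Prop) : Data :=
  open Classical in if P then cons nil nil else nil

end Data

/-- The contents of the variables. -/
abbrev Store : Type := ℕ → Data

/-- Expressions over the variables `0, 1, 2, …`. -/
inductive Expr : Type
  | var : ℕ → Expr
  | nil : Expr
  | cons : Expr → Expr → Expr
  | fst : Expr → Expr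
  | snd : Expr → Expr

namespace Expr

/-- The value of an expression. -/
def eval : Expr → Store → Data
  | var x, s => s x
  | nil, _ => Data.nil
  | cons a b, s => Data.cons (a.eval s) (b.eval s)
  | fst a, s => (a.eval s).fst
  | snd a, s => (a.eval s).snd

/-- The number of steps that it takes to evaluate an expression: one per operation. -/
def cost : Expr → ℕ
  | var _ => 1
  | nil => 1
  | cons a b => a.cost + b.cost + 1
  | fst a => a.cost + 1
  | snd a => a.cost + 1

end Expr

/-- Programs. -/
inductive Prog : Type
  | skip : Prog
  | assign : ℕ → Expr → Prog
  | emit : Expr → Prog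
  | seq : Prog → Prog → Prog
  | cond : Expr → Prog → Prog → Prog
  | loop : Expr → Prog → Prog

/-- `Exec p s out t s'`: started with store `s`, the program `p` halts after exactly `t` steps with
store `s'`, having written the trees `out`, in this order. A condition counts as true if its value
is not `nil`; `loop e p` repeats `p` as long as `e` is true. -/
inductive Exec : Prog → Store → List Data → ℕ → Store → Prop
  | skip (s : Store) : Exec .skip s [] 1 s
  | assign (x : ℕ) (e : Expr) (s : Store) :
      Exec (.assign x e) s [] (e.cost + 1) (Function.update s x (e.eval s))
  | emit (e : Expr) (s : Store) :
      Exec (.emit e) s [e.eval s] (e.cost + (e.eval s).size + 1) s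
  | seq {p q : Prog} {s s₁ s₂ : Store} {o₁ o₂ : List Data} {t₁ t₂ : ℕ} :
      Exec p s o₁ t₁ s₁ → Exec q s₁ o₂ t₂ s₂ → Exec (.seq p q) s (o₁ ++ o₂) (t₁ + t₂ + 1) s₂
  | cond_true {e : Expr} {p q : Prog} {s s₁ : Store} {o : List Data} {t : ℕ} :
      e.eval s ≠ Data.nil → Exec p s o t s₁ → Exec (.cond e p q) s o (e.cost + t + 1) s₁
  | cond_false {e : Expr} {p q : Prog} {s s₁ : Store} {o : List Data} {t : ℕ} :
      e.eval s = Data.nil → Exec q s o t s₁ → Exec (.cond e p q) s o (e.cost + t + 1) s₁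
  | loop_stop {e : Expr} {p : Prog} {s : Store} :
      e.eval s = Data.nil → Exec (.loop e p) s [] (e.cost + 1) s
  | loop_step {e : Expr} {p : Prog} {s s₁ s₂ : Store} {o₁ o₂ : List Data} {t₁ t₂ : ℕ} :
      e.eval s ≠ Data.nil → Exec p s o₁ t₁ s₁ → Exec (.loop e p) s₁ o₂ t₂ s₂ →
      Exec (.loop e p) s (o₁ ++ o₂) (e.cost + t₁ + t₂ + 1) s₂

/-- The machine is deterministic. -/
theorem Exec.det {p : Prog} {s s₁ s₂ : Store} {o₁ o₂ : List Data} {t₁ t₂ : ℕ}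
    (h₁ : Exec p s o₁ t₁ s₁) (h₂ : Exec p s o₂ t₂ s₂) : o₁ = o₂ ∧ t₁ = t₂ ∧ s₁ = s₂ := by
  induction h₁ generalizing o₂ t₂ s₂ with
  | skip => cases h₂; simp
  | assign => cases h₂; simp
  | emit => cases h₂; simp
  | seq _ _ ih₁ ih₂ =>
    cases h₂ with
    | seq a b =>
      obtain ⟨rfl, rfl, rfl⟩ := ih₁ a
      obtain ⟨rfl, rfl, rfl⟩ := ih₂ b
      simp
  | cond_true h _ ih =>
    cases h₂ with
    | cond_true _ a => obtain ⟨rfl, rfl, rfl⟩ := ih a; simp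
    | cond_false h' _ => exact absurd h' h
  | cond_false h _ ih =>
    cases h₂ with
    | cond_true h' _ => exact absurd h h'
    | cond_false _ a => obtain ⟨rfl, rfl, rfl⟩ := ih a; simp
  | loop_stop h =>
    cases h₂ with
    | loop_stop => simp
    | loop_step h' _ _ => exact absurd h h'
  | loop_step h _ _ ih₁ ih₂ =>
    cases h₂ with
    | loop_stop h' => exact absurd h' h
    | loop_step _ a b =>
      obtain ⟨rfl, rfl, rfl⟩ := ih₁ a
      obtain ⟨rfl, rfl, rfl⟩ := ih₂ b
      simp

/-- On the given input (the initial value of the variable `0`; all other variables are initially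
`nil`), the program `p` halts after exactly `t` steps, having written the trees `out`. -/
def Prog.Runs (p : Prog) (input : Data) (out : List Data) (t : ℕ) : Prop :=
  ∃ s : Store, Exec p (Function.update (fun _ => Data.nil) 0 input) out t s

end TreeMachine

/-! ## Enumeration of minimal transversals -/

namespace TransversalEnumeration

open TreeMachine

/-- The list `l` contains every element of `A`, exactly once, and nothing else. -/
def Lists {β : Type*} (l : List β) (A : Set β) : Prop :=
  l.Nodup ∧ ∀ x, x ∈ l ↔ x ∈ A

/-- A set of vertices as its characteristic vector, the vertices being listed by `vs`. -/
noncomputable def encodeSet {α : Type*} (vs : List α) (S : Set α) : Data :=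
  Data.ofList (vs.map fun v => Data.ofProp (v ∈ S))

/-- A hypergraph, given by a list of its vertices and a list of its hyperedges: the number of
vertices in unary, and the list of the characteristic vectors of the hyperedges. -/
noncomputable def encodeHypergraph {α : Type*} (vs : List α) (es : List (Set α)) : Data :=
  Data.cons (Data.ofList (vs.map fun _ => Data.nil)) (Data.ofList (es.map (encodeSet vs)))

/-- In whatever order the vertices and the hyperedges of `H` are presented to it, the program `p`
writes every minimal transversal of `H` exactly once (in some order), writes nothing else, and halts
after at most `b` steps. -/
def EnumeratesWithin {α : Type*} (p : Prog) (H : Hypergraph α) (b : ℕ) : Prop :=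
  ∀ (vs : List α) (es : List (Set α)), Lists vs H.vertexSet → Lists es H.edgeSet →
    ∃ (out : List (Set α)) (t : ℕ), Lists out {S | H.IsMinimalTransversal S} ∧ t ≤ b ∧
      p.Runs (encodeHypergraph vs es) (out.map (encodeSet vs)) t

end TransversalEnumeration

/-! ## Polynomial-time functions on encoded data -/

namespace TreeMachine

/-! The method is a derandomized monotone local search. Suppose that a set `A` lies in a minimal
transversal `S` with at most `j` elements of `S` outside `A`. Then a branching search finds `S`:
take a hyperedge that the current set misses and decide one of its undecided vertices. Putting the
vertex in lowers the budget `j`. Leaving it out lowers the number of undecided vertices of that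
hyperedge, which is at most 4. So the tree has at most `25 * 5 ^ j` nodes. Once every hyperedge is
hit, the current set is a transversal contained in `S`, hence equal to `S` by minimality.

It remains to choose the pairs `(A, j)` cheaply. On a ground set of `b` elements give `(A, j)` the
weight `(4/5)^|A| * (1/5)^j` and the cost `5 ^ j`. For each `K`, the weights of the pairs with `A ⊆
K` and `j = |K \ A|` sum to `(4/5 + 1/5)^|K| = 1`. This is a fractional cover of all subsets, of
total cost `(b + 1) * (9/5)^b`. Greedy set cover (`exists_cover`) turns it into an actual family and
loses only a factor `b + 1` (`exists_finset_cover`). The vertices are cut into blocks of a fixed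
size `b`, and a pair is guessed for each block from a table that is part of the program
(`exists_blockTable`). Costs multiply over the blocks, which gives `1.88 ^ n` up to polynomial
factors, below `1.8863 ^ n`.

Nothing is written twice. The table fixes one canonical guess for every subset of a block, a leaf
writes its set only if its guesses are the canonical ones (`accepts`), and a branching splits the
sets by membership of one vertex. `searchTree` collects correctness, disjointness and the bound on
the number of nodes.

For the machine, `PolyTime` is a class of functions closed under the usual list operations, which
yields `polyTime_step`. `exists_search` runs a search with such a step function on a stack, at
polynomial cost per node. Nodes have size polynomial in `n` because bounded rank leaves only
polynomially many hyperedges (`length_edges_le`). The counting bound follows from the time bound,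
since every output takes a step (`Exec.length_le`). -/

/-- Types whose elements are represented by trees. -/
class Enc (α : Type*) where
  enc : α → Data

namespace Enc

instance : Enc Data := ⟨id⟩
instance : Enc Unit := ⟨fun _ => Data.nil⟩
instance : Enc Bool := ⟨fun b => bif b then Data.cons Data.nil Data.nil else Data.nil⟩
instance {α : Type*} [Enc α] : Enc (Option α) :=
  ⟨fun o => o.elim Data.nil fun a => Data.cons (enc a) Data.nil⟩
instance {α β : Type*} [Enc α] [Enc β] : Enc (α × β) := ⟨fun x => Data.cons (enc x.1) (enc x.2)⟩
instance {α : Type*} [Enc α] : Enc (List α) := ⟨fun l => Data.ofList (l.map enc)⟩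
instance : Enc ℕ := ⟨fun n => Data.ofList (List.replicate n Data.nil)⟩
instance {k : ℕ} : Enc (Fin k) := ⟨fun i => enc (i : ℕ)⟩

end Enc

/-! ### Sizes of representations -/

section EncLemmas

variable {α β : Type*} [Enc α] [Enc β]

@[simp] theorem enc_data (d : Data) : Enc.enc d = d := rfl
@[simp] theorem enc_true : Enc.enc true = Data.cons Data.nil Data.nil := rfl
@[simp] theorem enc_false : Enc.enc false = Data.nil := rfl
@[simp] theorem enc_none : Enc.enc (none : Option α) = Data.nil := rfl
@[simp] theorem enc_some (a : α) : Enc.enc (some a) = Data.cons (Enc.enc a) Data.nil := rfl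
@[simp] theorem enc_prod (x : α × β) : Enc.enc x = Data.cons (Enc.enc x.1) (Enc.enc x.2) := rfl
@[simp] theorem enc_listNil : Enc.enc ([] : List α) = Data.nil := rfl
@[simp] theorem enc_listCons (a : α) (l : List α) :
    Enc.enc (a :: l) = Data.cons (Enc.enc a) (Enc.enc l) := rfl
@[simp] theorem enc_zero : Enc.enc (0 : ℕ) = Data.nil := rfl
@[simp] theorem enc_succ (n : ℕ) : Enc.enc (n + 1) = Data.cons Data.nil (Enc.enc n) := rfl
theorem enc_fin {k : ℕ} (i : Fin k) : Enc.enc i = Enc.enc (i : ℕ) := rfl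

/-- The size of the representation of an element. -/
def esize (a : α) : ℕ := (Enc.enc a).size

theorem Data.size_pos (d : Data) : 1 ≤ d.size := by
  cases d <;> simp [Data.size]

theorem esize_pos (a : α) : 1 ≤ esize a := Data.size_pos _

@[simp] theorem esize_prod (a : α) (b : β) : esize (a, b) = esize a + esize b + 1 := rfl
@[simp] theorem esize_nil : esize ([] : List α) = 1 := rfl
@[simp] theorem esize_cons (a : α) (l : List α) : esize (a :: l) = esize a + esize l + 1 := rfl
@[simp] theorem esize_none : esize (none : Option α) = 1 := rfl
@[simp] theorem esize_some (a : α) : esize (some a) = esize a + 2 := rfl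
theorem esize_bool (b : Bool) : esize b ≤ 3 := by cases b <;> simp [esize, Data.size]

theorem esize_nat (n : ℕ) : esize n = 2 * n + 1 := by
  induction n with
  | zero => rfl
  | succ n ih =>
    simp only [esize, enc_succ, Data.size] at *
    omega

theorem esize_fst_le (x : α × β) : esize x.1 ≤ esize x := by
  obtain ⟨a, b⟩ := x
  simp only [esize_prod]; omega

theorem esize_snd_le (x : α × β) : esize x.2 ≤ esize x := by
  obtain ⟨a, b⟩ := x
  simp only [esize_prod]; omega

theorem esize_mem_le {l : List α} {a : α} (h : a ∈ l) : esize a ≤ esize l := by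
  induction l with
  | nil => simp at h
  | cons b l ih =>
    simp only [esize_cons]
    rcases List.mem_cons.1 h with rfl | h
    · omega
    · have := ih h; omega

theorem length_le_esize (l : List α) : l.length ≤ esize l := by
  induction l with
  | nil => simp
  | cons b l ih => simp only [esize_cons, List.length_cons]; omega

theorem esize_append (l l' : List α) : esize (l ++ l') + 1 = esize l + esize l' := by
  induction l with
  | nil => simp [add_comm]
  | cons b l ih => simp only [esize_cons, List.cons_append]; omega

theorem esize_reverse (l : List α) : esize l.reverse = esize l := by
  induction l with
  | nil => rfl
  | cons b l ih =>
    have := esize_append l.reverse [b]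
    simp only [esize_cons, esize_nil, List.reverse_cons] at *
    omega

theorem esize_list_le {l : List α} {B : ℕ} (h : ∀ a ∈ l, esize a ≤ B) :
    esize l ≤ l.length * (B + 1) + 1 := by
  induction l with
  | nil => simp
  | cons b l ih =>
    have h1 := h b (by simp)
    have h2 := ih fun a ha => h a (by simp [ha])
    simp only [esize_cons, List.length_cons, add_mul]
    omega

end EncLemmas

/-! ### Polynomial bounds -/

/-- `g` is bounded by a polynomial in the size of its argument. -/
def PolyBounded {α : Type*} [Enc α] (g : α → ℕ) : Prop :=
  ∃ c, ∀ a, g a ≤ (esize a + 1) ^ c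

namespace PolyBounded

variable {α β : Type*} [Enc α] [Enc β] {g h : α → ℕ}

theorem mono (hh : PolyBounded h) (H : ∀ a, g a ≤ h a) : PolyBounded g :=
  hh.imp fun _ hc a => (H a).trans (hc a)

/-- The base `esize a + 1` is at least 2, so constants are absorbed by the exponent: `k < 2 ^ k`.
This is why a bare power can stand for an arbitrary polynomial. -/
theorem const (k : ℕ) : PolyBounded fun _ : α => k :=
  ⟨k, fun a => (Nat.lt_two_pow_self).le.trans
    (Nat.pow_le_pow_left (by have := esize_pos a; omega) k)⟩

theorem size : PolyBounded fun a : α => esize a := ⟨1, fun a => by simp⟩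

theorem add (hg : PolyBounded g) (hh : PolyBounded h) : PolyBounded fun a => g a + h a := by
  obtain ⟨c, hc⟩ := hg
  obtain ⟨d, hd⟩ := hh
  refine ⟨c + d + 1, fun a => ?_⟩
  have h1 : (esize a + 1) ^ c ≤ (esize a + 1) ^ (c + d) :=
    Nat.pow_le_pow_right (by omega) (by omega)
  have h2 : (esize a + 1) ^ d ≤ (esize a + 1) ^ (c + d) :=
    Nat.pow_le_pow_right (by omega) (by omega)
  have h3 : (esize a + 1) ^ (c + d) * 2 ≤ (esize a + 1) ^ (c + d) * (esize a + 1) :=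
    Nat.mul_le_mul_left _ (by have := esize_pos a; omega)
  rw [pow_succ]
  have := hc a
  have := hd a
  dsimp only
  omega

theorem mul (hg : PolyBounded g) (hh : PolyBounded h) : PolyBounded fun a => g a * h a := by
  obtain ⟨c, hc⟩ := hg
  obtain ⟨d, hd⟩ := hh
  exact ⟨c + d, fun a => by rw [pow_add]; exact Nat.mul_le_mul (hc a) (hd a)⟩

theorem pow (hg : PolyBounded g) (k : ℕ) : PolyBounded fun a => g a ^ k := by
  obtain ⟨c, hc⟩ := hg
  exact ⟨c * k, fun a => by rw [pow_mul]; exact Nat.pow_le_pow_left (hc a) k⟩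

theorem comp {g : β → ℕ} {f : α → β} (hg : PolyBounded g) (hf : PolyBounded fun a => esize (f a)) :
    PolyBounded fun a => g (f a) := by
  obtain ⟨c, hc⟩ := hg
  exact ((hf.add (const 1)).pow c).mono fun a => hc (f a)

end PolyBounded

/-! ### Programs that compute functions -/

/-- Started with `d` in the variable `0`, the program `p` halts within `T` steps with `d'` in the
variable `0`, without output; the variable `1`, used as a stack, keeps its value. -/
def Computes (p : Prog) (d d' : Data) (T : ℕ) : Prop :=
  ∀ s : Store, s 0 = d → ∃ s' t, Exec p s [] t s' ∧ s' 0 = d' ∧ s' 1 = s 1 ∧ t ≤ T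

namespace Computes

theorem mono {p : Prog} {d d' : Data} {T T' : ℕ} (h : Computes p d d' T) (hT : T ≤ T') :
    Computes p d d' T' := fun s hs => by
  obtain ⟨s', t, h1, h2, h3, h4⟩ := h s hs
  exact ⟨s', t, h1, h2, h3, h4.trans hT⟩

theorem seq {p q : Prog} {d d' d'' : Data} {T T' : ℕ} (hp : Computes p d d' T)
    (hq : Computes q d' d'' T') : Computes (.seq p q) d d'' (T + T' + 1) := fun s hs => by
  obtain ⟨s1, t1, h1, h2, h3, h4⟩ := hp s hs
  obtain ⟨s2, t2, k1, k2, k3, k4⟩ := hq s1 h2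
  exact ⟨s2, _, by simpa using Exec.seq h1 k1, k2, k3.trans h3, by omega⟩

/-- Replace the contents of the variable `0` by the value of an expression. -/
theorem assign {e : Expr} {d d' : Data} (h : ∀ s : Store, s 0 = d → e.eval s = d') :
    Computes (.assign 0 e) d d' (e.cost + 1) := fun s hs =>
  ⟨_, _, Exec.assign 0 e s, by simp [h s hs], by simp, le_rfl⟩

theorem cond_true {e : Expr} {p q : Prog} {d d' : Data} {T : ℕ}
    (h : ∀ s : Store, s 0 = d → e.eval s ≠ Data.nil) (hp : Computes p d d' T) :
    Computes (.cond e p q) d d' (e.cost + T + 1) := fun s hs => by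
  obtain ⟨s1, t1, h1, h2, h3, h4⟩ := hp s hs
  exact ⟨s1, _, Exec.cond_true (h s hs) h1, h2, h3, by omega⟩

theorem cond_false {e : Expr} {p q : Prog} {d d' : Data} {T : ℕ}
    (h : ∀ s : Store, s 0 = d → e.eval s = Data.nil) (hq : Computes q d d' T) :
    Computes (.cond e p q) d d' (e.cost + T + 1) := fun s hs => by
  obtain ⟨s1, t1, h1, h2, h3, h4⟩ := hq s hs
  exact ⟨s1, _, Exec.cond_false (h s hs) h1, h2, h3, by omega⟩

theorem loop_stop {e : Expr} {p : Prog} {d : Data}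
    (h : ∀ s : Store, s 0 = d → e.eval s = Data.nil) : Computes (.loop e p) d d (e.cost + 1) :=
  fun s hs => ⟨s, _, Exec.loop_stop (h s hs), hs, rfl, le_rfl⟩

theorem loop_step {e : Expr} {p : Prog} {d d' d'' : Data} {T T' : ℕ}
    (h : ∀ s : Store, s 0 = d → e.eval s ≠ Data.nil) (hp : Computes p d d' T)
    (hl : Computes (.loop e p) d' d'' T') :
    Computes (.loop e p) d d'' (e.cost + T + T' + 1) := fun s hs => by
  obtain ⟨s1, t1, h1, h2, h3, h4⟩ := hp s hs
  obtain ⟨s2, t2, k1, k2, k3, k4⟩ := hl s1 h2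
  exact ⟨s2, _, by simpa using Exec.loop_step (h s hs) h1 k1, k2, k3.trans h3, by omega⟩

end Computes

/-- Apply `p` to the second component of the contents of the variable `0`. -/
def Prog.onSnd (p : Prog) : Prog :=
  .seq (.assign 1 (.cons (.fst (.var 0)) (.var 1))) <| .seq (.assign 0 (.snd (.var 0))) <|
    .seq p <| .seq (.assign 0 (.cons (.fst (.var 1)) (.var 0))) (.assign 1 (.snd (.var 1)))

/-- The first component is parked on the stack in the variable `1` while `p` runs. It can be
recovered because `Computes` requires `p` to leave that variable as it was. -/
theorem Computes.onSnd {p : Prog} {d d' : Data} {T : ℕ} (h : Computes p d d' T) (e : Data) :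
    Computes p.onSnd (Data.cons e d) (Data.cons e d') (T + 24) := fun s hs => by
  set s1 := Function.update s 1 (Data.cons e (s 1)) with hs1
  set s2 := Function.update s1 0 d with hs2
  obtain ⟨s3, t, h1, h2, h3, h4⟩ := h s2 (by simp [hs2])
  have e1 := Exec.assign 1 (.cons (.fst (.var 0)) (.var 1)) s
  have e2 := Exec.assign 0 (.snd (.var 0)) s1
  have e3 := Exec.assign 0 (.cons (.fst (.var 1)) (.var 0)) s3
  have e4 := Exec.assign 1 (.snd (.var 1)) (Function.update s3 0
    ((Expr.cons (.fst (.var 1)) (.var 0)).eval s3))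
  have E1 : Function.update s 1 ((Expr.cons (.fst (.var 0)) (.var 1)).eval s) = s1 := by
    simp [Expr.eval, hs, Data.fst, hs1]
  have E2 : Function.update s1 0 ((Expr.snd (.var 0)).eval s1) = s2 := by
    simp [Expr.eval, hs, Data.snd, hs2, hs1]
  rw [E1] at e1
  rw [E2] at e2
  have h31 : s3 1 = Data.cons e (s 1) := by rw [h3]; simp [hs2, hs1]
  have e := Exec.seq e1 (Exec.seq e2 (Exec.seq h1 (Exec.seq e3 e4)))
  simp only [List.append_nil] at e
  refine ⟨_, _, e, ?_, ?_, ?_⟩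
  · simp [Expr.eval, h31, h2, Data.fst]
  · simp [Expr.eval, h31, Data.snd]
  · simp only [Expr.cost]; omega

/-! ### Polynomial-time computable functions -/

/-- `f` is computed by a program in polynomial time, and its values have polynomial size. -/
def PolyTime {α β : Type*} [Enc α] [Enc β] (f : α → β) : Prop :=
  (∃ (p : Prog) (T : α → ℕ), PolyBounded T ∧ ∀ a, Computes p (Enc.enc a) (Enc.enc (f a)) (T a)) ∧
    PolyBounded fun a => esize (f a)

namespace PolyTime

variable {α β γ δ : Type*} [Enc α] [Enc β] [Enc γ] [Enc δ]

/-- Functions that an expression computes. -/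
theorem of_expr {f : α → β} (e : Expr)
    (h : ∀ a (s : Store), s 0 = Enc.enc a → e.eval s = Enc.enc (f a))
    (hf : PolyBounded fun a => esize (f a)) : PolyTime f :=
  ⟨⟨.assign 0 e, fun _ => e.cost + 1, .const _, fun a => .assign (h a)⟩, hf⟩

/-- The running time of the second program is polynomial in the size of `f a`, so that size must be
controlled. The time bound alone does not do it: a `cons` of a variable with itself doubles a tree
in constant time. -/
theorem comp {g : β → γ} {f : α → β} (hg : PolyTime g) (hf : PolyTime f) :
    PolyTime fun a => g (f a) := by
  obtain ⟨⟨p, T, hT, hp⟩, hs⟩ := hf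
  obtain ⟨⟨p', T', hT', hp'⟩, hs'⟩ := hg
  exact ⟨⟨.seq p p', _, (hT.add (hT'.comp hs)).add (.const 1), fun a => (hp a).seq (hp' (f a))⟩,
    hs'.comp hs⟩

theorem of_eq {f g : α → β} (hf : PolyTime f) (h : ∀ a, f a = g a) : PolyTime g := by
  obtain rfl : f = g := funext h
  exact hf

/-- Functions that do not change the representation. -/
theorem of_enc_eq {f : α → β} (h : ∀ a, Enc.enc (f a) = Enc.enc a) : PolyTime f :=
  of_expr (.var 0) (fun a s hs => by simp [Expr.eval, hs, h])
    (PolyBounded.size.mono fun a => by simp [esize, h])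

theorem id : PolyTime fun a : α => a := of_enc_eq fun _ => rfl

theorem fst : PolyTime fun x : α × β => x.1 :=
  of_expr (.fst (.var 0)) (fun a s hs => by simp [Expr.eval, hs, Data.fst])
    (PolyBounded.size.mono esize_fst_le)

theorem snd : PolyTime fun x : α × β => x.2 :=
  of_expr (.snd (.var 0)) (fun a s hs => by simp [Expr.eval, hs, Data.snd])
    (PolyBounded.size.mono esize_snd_le)

theorem exists_expr_const (d : Data) : ∃ e : Expr, ∀ s, e.eval s = d := by
  induction d with
  | nil => exact ⟨.nil, fun s => rfl⟩
  | cons a b iha ihb =>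
    obtain ⟨e, he⟩ := iha
    obtain ⟨f, hf⟩ := ihb
    exact ⟨.cons e f, fun s => by simp [Expr.eval, he, hf]⟩

theorem const (b : β) : PolyTime fun _ : α => b := by
  obtain ⟨e, he⟩ := exists_expr_const (Enc.enc b)
  exact of_expr e (fun a s _ => he s) (.const _)

theorem pair {f : α → β} {g : α → γ} (hf : PolyTime f) (hg : PolyTime g) :
    PolyTime fun a => (f a, g a) := by
  obtain ⟨⟨p, T, hT, hp⟩, hs⟩ := hf
  obtain ⟨⟨p', T', hT', hp'⟩, hs'⟩ := hg
  let dup : Expr := .cons (.var 0) (.var 0)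
  let swap : Expr := .cons (.snd (.var 0)) (.fst (.var 0))
  refine ⟨⟨.seq (.assign 0 dup) <| .seq p.onSnd <| .seq (.assign 0 swap) p'.onSnd,
    fun a => T a + T' a + 100, (hT.add hT').add (.const _), fun a => ?_⟩, ?_⟩
  · have h1 : Computes (.assign 0 dup) (Enc.enc a) (Data.cons (Enc.enc a) (Enc.enc a)) _ :=
      .assign fun s hs => by simp [dup, Expr.eval, hs]
    have h2 : Computes (.assign 0 swap) (Data.cons (Enc.enc a) (Enc.enc (f a)))
        (Data.cons (Enc.enc (f a)) (Enc.enc a)) _ :=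
      .assign fun s hs => by simp [swap, Expr.eval, hs, Data.fst, Data.snd]
    refine (h1.seq (((hp a).onSnd _).seq (h2.seq ((hp' a).onSnd _)))).mono ?_
    simp only [dup, swap, Expr.cost]; omega
  · exact ((hs.add hs').add (.const 1)).mono fun a => by simp

theorem cons {f : α → β} {g : α → List β} (hf : PolyTime f) (hg : PolyTime g) :
    PolyTime fun a => f a :: g a :=
  (of_enc_eq (f := fun x : β × List β => x.1 :: x.2) fun _ => rfl).comp (hf.pair hg)

theorem some {f : α → β} (hf : PolyTime f) : PolyTime fun a => Option.some (f a) :=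
  (of_enc_eq (f := fun x : β × Unit => Option.some x.1) fun _ => rfl).comp (hf.pair (const ()))

theorem tail {f : α → List β} (hf : PolyTime f) : PolyTime fun a => (f a).tail :=
  comp (g := fun l : List β => l.tail)
    (of_expr (.snd (.var 0)) (fun l s hs => by cases l <;> simp [Expr.eval, hs, Data.snd])
      (PolyBounded.size.mono fun l => by
        cases l <;> simp only [esize_cons, List.tail] <;> omega)) hf

theorem head? {f : α → List β} (hf : PolyTime f) : PolyTime fun a => (f a).head? :=
  comp (g := fun l : List β => l.head?)
    ⟨⟨.cond (.var 0) (.assign 0 (.cons (.fst (.var 0)) .nil)) .skip, fun _ => 100, .const _,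
      fun l => by
        cases l with
        | nil =>
          exact .mono (.cond_false (T := 1) (fun s hs => by simp [Expr.eval, hs])
            fun s hs => ⟨s, _, Exec.skip s, hs, rfl, le_rfl⟩) (by simp [Expr.cost])
        | cons b l =>
          exact .mono (.cond_true (fun s hs => by simp [Expr.eval, hs])
            (.assign fun s hs => by simp [Expr.eval, hs, Data.fst])) (by simp [Expr.cost])⟩,
      (PolyBounded.size.add (.const 1)).mono fun l => by
        cases l <;> simp⟩ hf

theorem headD {f : α → List Bool} (hf : PolyTime f) : PolyTime fun a => (f a).headD false :=
  comp (g := fun l : List Bool => l.headD false)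
    (of_expr (.fst (.var 0)) (fun l s hs => by cases l <;> simp [Expr.eval, hs, Data.fst])
      ((PolyBounded.const 3).mono fun l => esize_bool _)) hf

theorem succ {f : α → ℕ} (hf : PolyTime f) : PolyTime fun a => f a + 1 :=
  (of_enc_eq (f := fun x : Unit × ℕ => x.2 + 1) fun _ => rfl).comp ((const ()).pair hf)

theorem pred {f : α → ℕ} (hf : PolyTime f) : PolyTime fun a => f a - 1 :=
  comp (g := fun n : ℕ => n - 1)
    (of_expr (.snd (.var 0)) (fun n s hs => by cases n <;> simp [Expr.eval, hs, Data.snd])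
      (PolyBounded.size.mono fun l => by simp only [esize_nat]; omega)) hf

/-- Case distinction. The program tests whether the representation of `c a` is `nil`. -/
theorem cases {c : α → γ} {P : α → Prop} [DecidablePred P] {f g : α → β} (hc : PolyTime c)
    (hP : ∀ a, Enc.enc (c a) ≠ Data.nil ↔ P a)
    (hf : PolyTime f) (hg : PolyTime g) : PolyTime fun a => if P a then f a else g a := by
  obtain ⟨⟨p, T, hT, hp⟩, hs⟩ := hf
  obtain ⟨⟨p', T', hT', hp'⟩, hs'⟩ := hg
  obtain ⟨⟨q, S, hS, hq⟩, -⟩ := hc.pair (id (α := α))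
  refine ⟨⟨.seq q (.cond (.fst (.var 0)) (.seq (.assign 0 (.snd (.var 0))) p)
    (.seq (.assign 0 (.snd (.var 0))) p')), fun a => S a + (T a + T' a) + 100,
    (hS.add (hT.add hT')).add (.const _), fun a => ?_⟩, (hs.add hs').mono fun a => ?_⟩
  · have hsnd : Computes (.assign 0 (.snd (.var 0))) (Enc.enc (c a, a)) (Enc.enc a) _ :=
      .assign fun s hs => by simp [Expr.eval, hs, Data.snd]
    by_cases h : P a
    · have := (hq a).seq (.cond_true (q := .seq (.assign 0 (.snd (.var 0))) p')
        (e := .fst (.var 0))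
        (fun s hs => by simpa [Expr.eval, hs, Data.fst] using (hP a).2 h) (hsnd.seq (hp a)))
      simp only [h, if_true]
      exact this.mono (by simp only [Expr.cost]; omega)
    · have := (hq a).seq (.cond_false (p := .seq (.assign 0 (.snd (.var 0))) p)
        (e := .fst (.var 0))
        (fun s hs => by simpa [Expr.eval, hs, Data.fst] using (hP a).not.2 h) (hsnd.seq (hp' a)))
      simp only [h, if_false]
      exact this.mono (by simp only [Expr.cost]; omega)
  · dsimp only; split <;> omega

theorem ite {c : α → Bool} {f g : α → β} (hc : PolyTime c) (hf : PolyTime f) (hg : PolyTime g) :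
    PolyTime fun a => if c a = true then f a else g a :=
  cases hc (fun a => by cases h : c a <;> simp) hf hg

theorem ite_nil {c : α → List γ} {f g : α → β} (hc : PolyTime c) (hf : PolyTime f)
    (hg : PolyTime g) : PolyTime fun a => if c a ≠ [] then f a else g a :=
  cases hc (fun a => by cases h : c a <;> simp) hf hg

theorem ite_zero {c : α → ℕ} {f g : α → β} (hc : PolyTime c) (hf : PolyTime f)
    (hg : PolyTime g) : PolyTime fun a => if c a ≠ 0 then f a else g a :=
  cases hc (fun a => by cases h : c a <;> simp) hf hg

theorem option_elim {c : α → Option γ} {f : α → β} {g : α × γ → β} (hc : PolyTime c)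
    (hf : PolyTime f) (hg : PolyTime g) :
    PolyTime fun a => (c a).elim (f a) fun x => g (a, x) := by
  obtain ⟨⟨p, T, hT, hp⟩, hs⟩ := hf
  obtain ⟨⟨p', T', hT', hp'⟩, hs'⟩ := hg
  obtain ⟨⟨q, S, hS, hq⟩, hsc⟩ := (id (α := α)).pair hc
  have hcs : PolyBounded fun a => esize (c a) := hc.2
  -- The element `x` exists only in one case, so the argument `(a, x)` is not a function of `a` to
  -- which `PolyBounded.comp` applies. The polynomial is opened up and evaluated at a bound in terms
  -- of `esize (c a)`.
  obtain ⟨k, hk⟩ := hT'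
  obtain ⟨l, hl⟩ := hs'
  refine ⟨⟨.seq q (.cond (.snd (.var 0))
    (.seq (.assign 0 (.cons (.fst (.var 0)) (.fst (.snd (.var 0))))) p')
    (.seq (.assign 0 (.fst (.var 0))) p)),
    fun a => S a + (T a + (esize a + esize (c a) + 1 + 1) ^ k) + 100,
    (hS.add (hT.add ((((PolyBounded.size.add hcs).add (.const _)).add (.const _)).pow _))).add
      (.const _), fun a => ?_⟩,
    (hs.add ((((PolyBounded.size.add hcs).add (.const 1)).add (.const 1)).pow l)).mono fun a => ?_⟩
  · cases h : c a with
    | none =>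
      have h1 := hq a
      simp only [h] at h1
      have h2 : Computes (.assign 0 (.fst (.var 0))) (Enc.enc (a, (none : Option γ)))
          (Enc.enc a) _ :=
        .assign fun s hs => by simp [Expr.eval, hs, Data.fst]
      have := h1.seq (.cond_false (p :=
        .seq (.assign 0 (.cons (.fst (.var 0)) (.fst (.snd (.var 0))))) p')
        (e := .snd (.var 0))
        (fun s hs => by simp [Expr.eval, hs, Data.snd]) (h2.seq (hp a)))
      simp only [h]
      exact this.mono (by simp only [Expr.cost]; omega)
    | some x =>
      have h1 := hq a
      simp only [h] at h1
      have h2 : Computes (.assign 0 (.cons (.fst (.var 0)) (.fst (.snd (.var 0)))))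
          (Enc.enc (a, Option.some x)) (Enc.enc (a, x)) _ :=
        .assign fun s hs => by simp [Expr.eval, hs, Data.fst, Data.snd]
      have := h1.seq (.cond_true (q := .seq (.assign 0 (.fst (.var 0))) p)
        (e := .snd (.var 0))
        (fun s hs => by simp [Expr.eval, hs, Data.snd]) (h2.seq (hp' (a, x))))
      simp only [h]
      refine this.mono ?_
      have h3 : T' (a, x) ≤ (esize a + (esize x + 2) + 1 + 1) ^ k :=
        (hk _).trans (Nat.pow_le_pow_left (by simp) k)
      simp only [Expr.cost, esize_some]; omega
  · cases h : c a with
    | none => simp [h]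
    | some x =>
      have h3 : esize (g (a, x)) ≤ (esize a + (esize x + 2) + 1 + 1) ^ l :=
        (hl _).trans (Nat.pow_le_pow_left (by simp) l)
      simp only [h, esize_some, Option.elim]; omega

theorem not {f : α → Bool} (hf : PolyTime f) : PolyTime fun a => !f a :=
  (hf.ite (const false) (const true)).of_eq fun a => by cases f a <;> rfl

theorem and {f g : α → Bool} (hf : PolyTime f) (hg : PolyTime g) : PolyTime fun a => f a && g a :=
  (hf.ite hg (const false)).of_eq fun a => by cases f a <;> simp

theorem or {f g : α → Bool} (hf : PolyTime f) (hg : PolyTime g) : PolyTime fun a => f a || g a :=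
  (hf.ite (const true) hg).of_eq fun a => by cases f a <;> simp

end PolyTime

/-! ### List operations -/

section

variable {α β γ δ : Type*} [Enc α] [Enc β] [Enc γ] [Enc δ]

theorem esize_sublist {l l' : List α} (h : l'.Sublist l) : esize l' ≤ esize l := by
  induction h with
  | slnil => exact le_rfl
  | cons a _ ih => simp only [esize_cons]; omega
  | cons_cons a _ ih => simp only [esize_cons]; omega

theorem esize_zip_le (l : List α) (r : List β) : esize (l.zip r) ≤ esize l + esize r := by
  induction l generalizing r with
  | nil => simp
  | cons a l ih =>
    cases r with
    | nil => simp
    | cons b r =>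
      have := ih r
      simp only [List.zip_cons_cons, esize_cons, esize_prod]; omega

namespace PolyTime

/-- The body of the loop for `List.foldl`: the variable `0` holds the environment, the accumulator
and the rest of the list. -/
def foldlBody (p : Prog) : Prog :=
  .seq (.assign 0 (.cons (.cons (.fst (.var 0)) (.snd (.snd (.snd (.var 0)))))
    (.cons (.cons (.fst (.var 0)) (.fst (.snd (.var 0)))) (.fst (.snd (.snd (.var 0))))))) <|
  .seq p.onSnd <|
  .assign 0 (.cons (.fst (.fst (.var 0))) (.cons (.snd (.var 0)) (.snd (.fst (.var 0)))))

/-- The time of one round is needed only for accumulators that occur, that is, for folds over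
prefixes of the list. For these `foldl` assumes a size bound; an arbitrary iteration of a
polynomial-time function could blow up. -/
theorem computes_foldl {p : Prog} {f : (δ × β) × α → β} {T : (δ × β) × α → ℕ}
    (hp : ∀ x, Computes p (Enc.enc x) (Enc.enc (f x)) (T x)) (x : δ) (τ : ℕ) (l : List α) (b : β)
    (h : ∀ l' a, l' ++ [a] <+: l → T ((x, l'.foldl (fun b a => f ((x, b), a)) b), a) ≤ τ) :
    Computes (.loop (.snd (.snd (.var 0))) (foldlBody p)) (Enc.enc (x, b, l))
      (Enc.enc (x, l.foldl (fun b a => f ((x, b), a)) b, ([] : List α)))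
      (l.length * (τ + 100) + 4) := by
  induction l generalizing b with
  | nil =>
    exact (Computes.loop_stop fun s hs => by simp [Expr.eval, hs, Data.snd]).mono
      (by simp [Expr.cost])
  | cons a l ih =>
    have h0 : T ((x, b), a) ≤ τ := h [] a (by simp)
    have h1 := ih (f ((x, b), a)) fun l' a' hl =>
      h (a :: l') a' (by simpa using hl)
    have hb : Computes (foldlBody p) (Enc.enc (x, b, a :: l)) (Enc.enc (x, f ((x, b), a), l))
        (T ((x, b), a) + 90) := by
      have e1 : Computes (.assign 0 (.cons (.cons (.fst (.var 0)) (.snd (.snd (.snd (.var 0)))))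
          (.cons (.cons (.fst (.var 0)) (.fst (.snd (.var 0)))) (.fst (.snd (.snd (.var 0)))))))
          (Enc.enc (x, b, a :: l)) (Data.cons (Data.cons (Enc.enc x) (Enc.enc l))
            (Enc.enc ((x, b), a))) _ :=
        .assign fun s hs => by simp [Expr.eval, hs, Data.fst, Data.snd]
      have e2 : Computes
          (.assign 0 (.cons (.fst (.fst (.var 0))) (.cons (.snd (.var 0)) (.snd (.fst (.var 0))))))
          (Data.cons (Data.cons (Enc.enc x) (Enc.enc l)) (Enc.enc (f ((x, b), a))))
          (Enc.enc (x, f ((x, b), a), l)) _ :=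
        .assign fun s hs => by simp [Expr.eval, hs, Data.fst, Data.snd]
      exact (e1.seq (((hp _).onSnd _).seq e2)).mono (by simp only [Expr.cost]; omega)
    refine (Computes.loop_step (fun s hs => by simp [Expr.eval, hs, Data.snd]) hb h1).mono ?_
    simp only [Expr.cost, List.length_cons, add_mul]; omega

/-- Folding over a list, if the size of the accumulator stays polynomial. -/
theorem foldl {l : δ → List α} {i : δ → β} {f : (δ × β) × α → β} (hl : PolyTime l)
    (hi : PolyTime i) (hf : PolyTime f) {B : δ → ℕ} (hB : PolyBounded B)
    (h : ∀ x l', l' <+: l x → esize (l'.foldl (fun b a => f ((x, b), a)) (i x)) ≤ B x) :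
    PolyTime fun x => (l x).foldl (fun b a => f ((x, b), a)) (i x) := by
  obtain ⟨⟨p, T, ⟨c, hc⟩, hp⟩, -⟩ := hf
  obtain ⟨⟨q, S, hS, hq⟩, -⟩ := (id (α := δ)).pair (hi.pair hl)
  have hls := hl.2
  have hτ : PolyBounded fun x => (esize x + B x + esize (l x) + 3) ^ c :=
    (((PolyBounded.size.add hB).add hls).add (.const 3)).pow c
  refine ⟨⟨.seq q (.seq (.loop (.snd (.snd (.var 0))) (foldlBody p))
    (.assign 0 (.fst (.snd (.var 0))))), _,
    (hS.add ((hls.mul (hτ.add (.const 100))).add (.const 50))), fun x => ?_⟩,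
    hB.mono fun x => h x (l x) (List.prefix_refl _)⟩
  have h1 := computes_foldl hp x ((esize x + B x + esize (l x) + 3) ^ c) (l x) (i x)
      fun l' a hl' => by
    refine (hc _).trans (Nat.pow_le_pow_left ?_ c)
    have h1 := h x l' ((List.prefix_append _ _).trans hl')
    have h2 : esize a ≤ esize (l x) := esize_mem_le (hl'.subset (by simp))
    simp only [esize_prod]; omega
  have h2 : Computes (.assign 0 (.fst (.snd (.var 0))))
      (Enc.enc (x, (l x).foldl (fun b a => f ((x, b), a)) (i x), ([] : List α)))
      (Enc.enc ((l x).foldl (fun b a => f ((x, b), a)) (i x))) _ :=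
    .assign fun s hs => by simp [Expr.eval, hs, Data.fst, Data.snd]
  refine ((hq x).seq (h1.seq h2)).mono ?_
  have := Nat.mul_le_mul_right ((esize x + B x + esize (l x) + 3) ^ c + 100)
    (length_le_esize (l x))
  simp only [Expr.cost]; omega

theorem reverse {l : δ → List α} (hl : PolyTime l) : PolyTime fun x => (l x).reverse := by
  have e (l : List α) : l.foldl (fun b a => a :: b) [] = l.reverse := by simp
  refine (foldl (f := fun y => y.2 :: y.1.2) hl (const []) (snd.cons (snd.comp fst)) hl.2
    fun x l' h => ?_).of_eq fun x => e _
  rw [e, esize_reverse]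
  exact esize_sublist h.sublist

theorem foldr {l : δ → List α} {i : δ → β} {f : (δ × β) × α → β} (hl : PolyTime l)
    (hi : PolyTime i) (hf : PolyTime f) {B : δ → ℕ} (hB : PolyBounded B)
    (h : ∀ x l', l' <:+ l x → esize (l'.foldr (fun a b => f ((x, b), a)) (i x)) ≤ B x) :
    PolyTime fun x => (l x).foldr (fun a b => f ((x, b), a)) (i x) := by
  refine (foldl hl.reverse hi hf hB fun x l' h' => ?_).of_eq fun x => by
    rw [List.foldl_reverse]
  have := h x l'.reverse (by rw [← List.reverse_prefix]; simpa using h')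
  rwa [List.foldr_reverse] at this

theorem map {l : δ → List α} {f : δ × α → β} (hl : PolyTime l) (hf : PolyTime f) :
    PolyTime fun x => (l x).map fun a => f (x, a) := by
  obtain ⟨c, hc⟩ := hf.2
  have e (x : δ) (l : List α) :
      l.foldr (fun a b => f (x, a) :: b) [] = l.map fun a => f (x, a) := by
    induction l <;> simp_all
  have hB : PolyBounded fun x => esize (l x) * ((esize x + esize (l x) + 2) ^ c + 1) + 1 :=
    (hl.2.mul ((((PolyBounded.size.add hl.2).add (.const 2)).pow c).add (.const 1))).add (.const 1)
  refine (foldr (f := fun y => f (y.1.1, y.2) :: y.1.2) hl (const [])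
    ((hf.comp ((fst.comp fst).pair snd)).cons (snd.comp fst)) hB fun x l' h => ?_).of_eq
    fun x => e x _
  rw [e]
  refine (esize_list_le (B := (esize x + esize (l x) + 2) ^ c) fun b hb => ?_).trans ?_
  · obtain ⟨a, ha, rfl⟩ := List.mem_map.1 hb
    refine (hc _).trans (Nat.pow_le_pow_left ?_ c)
    have := esize_mem_le (h.subset ha)
    simp only [esize_prod]; omega
  · rw [List.length_map]
    have := Nat.mul_le_mul_right ((esize x + esize (l x) + 2) ^ c + 1)
      (h.length_le.trans (length_le_esize (l x)))
    omega

theorem any {l : δ → List α} {f : δ × α → Bool} (hl : PolyTime l) (hf : PolyTime f) :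
    PolyTime fun x => (l x).any fun a => f (x, a) := by
  have e (x : δ) (l : List α) :
      l.foldr (fun a b => f (x, a) || b) false = l.any fun a => f (x, a) := by
    induction l <;> simp_all
  exact (foldr (f := fun y => f (y.1.1, y.2) || y.1.2) hl (const false)
    ((hf.comp ((fst.comp fst).pair snd)).or (snd.comp fst)) (.const 3)
    fun x l' h => esize_bool _).of_eq fun x => e x _

theorem all {l : δ → List α} {f : δ × α → Bool} (hl : PolyTime l) (hf : PolyTime f) :
    PolyTime fun x => (l x).all fun a => f (x, a) :=
  (hl.any hf.not).not.of_eq fun x => by simp [List.all_eq_not_any_not]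

theorem find? {l : δ → List α} {f : δ × α → Bool} (hl : PolyTime l) (hf : PolyTime f) :
    PolyTime fun x => (l x).find? fun a => f (x, a) := by
  have e (x : δ) (l : List α) :
      l.foldr (fun a b => if f (x, a) = true then Option.some a else b) none =
        l.find? fun a => f (x, a) := by
    induction l with
    | nil => rfl
    | cons a l ih => cases h : f (x, a) <;> simp_all [List.find?]
  refine (foldr (f := fun y => if f (y.1.1, y.2) = true then Option.some y.2 else y.1.2) hl
    (const none) ((hf.comp ((fst.comp fst).pair snd)).ite snd.some (snd.comp fst))
    (hl.2.add (.const 3)) fun x l' h => ?_).of_eq fun x => e x _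
  rw [e]
  cases h' : l'.find? fun a => f (x, a) with
  | none => simp
  | some a =>
    have := esize_mem_le (h.subset (List.mem_of_find?_eq_some h'))
    simp only [esize_some]; omega

/-- A fold over `l` whose accumulator holds the unread part of `r` and the pairs collected so far,
in reverse order. -/
theorem zip {l : δ → List α} {r : δ → List β} (hl : PolyTime l) (hr : PolyTime r) :
    PolyTime fun x => (l x).zip (r x) := by
  let step : List β × List (α × β) → α → List β × List (α × β) := fun y a =>
    y.1.head?.elim y fun b => (y.1.tail, (a, b) :: y.2)
  have e (l : List α) (r : List β) (acc : List (α × β)) :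
      l.foldl step (r, acc) = (r.drop l.length, (l.zip r).reverse ++ acc) := by
    induction l generalizing r acc with
    | nil => simp
    | cons a l ih => cases r <;> simp [step, ih]
  have hstep : PolyTime fun y : (δ × (List β × List (α × β))) × α => step y.1.2 y.2 :=
    option_elim (c := fun y : (δ × (List β × List (α × β))) × α => y.1.2.1.head?)
      (f := fun y => y.1.2) (g := fun y => (y.1.1.2.1.tail, (y.1.2, y.2) :: y.1.1.2.2))
      (fst.comp (snd.comp fst)).head? (snd.comp fst)
      ((fst.comp (snd.comp (fst.comp fst))).tail.pair
        (((snd.comp fst).pair snd).cons (snd.comp (snd.comp (fst.comp fst)))))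
  have h1 : PolyTime fun x => (l x).foldl step (r x, []) := by
    refine foldl (f := fun y : (δ × (List β × List (α × β))) × α => step y.1.2 y.2) hl
      (hr.pair (const [])) hstep
      (hr.2.add ((hl.2.add hr.2).add (.const 1))) fun x l' h => ?_
    rw [e]
    have h1 := esize_sublist (List.drop_sublist l'.length (r x))
    have h2 := esize_zip_le l' (r x)
    have h3 := esize_sublist h.sublist
    simp only [List.append_nil, esize_prod, esize_reverse]; omega
  exact (snd.comp h1).reverse.of_eq fun x => by simp [e]

theorem drop {l : δ → List α} (hl : PolyTime l) (b : ℕ) : PolyTime fun x => (l x).drop b := by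
  induction b with
  | zero => simpa using hl
  | succ b ih => exact ih.tail.of_eq fun x => by simp

theorem append_const {l : δ → List α} (hl : PolyTime l) (k : List α) :
    PolyTime fun x => k ++ l x := by
  induction k with
  | nil => exact hl
  | cons a k ih => exact (const a).cons ih

theorem add_const {f : δ → ℕ} (hf : PolyTime f) (k : ℕ) : PolyTime fun x => f x + k := by
  induction k with
  | zero => exact hf
  | succ k ih => exact ih.succ

end PolyTime

/-- The first `b` elements of a list, padded with `false`. -/
def takePad : ℕ → List Bool → List Bool
  | 0, _ => []
  | b + 1, l => l.headD false :: takePad b l.tail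

@[simp] theorem length_takePad (b : ℕ) (l : List Bool) : (takePad b l).length = b := by
  induction b generalizing l <;> simp_all [takePad]

namespace PolyTime

/-- The program is a decision tree on the first `b` bits. It has a separate branch for each of the
finitely many values `K`, so `f` need only be computable for fixed `K`. This puts the table of
guesses into the program. -/
theorem apply_takePad {l : δ → List Bool} {f : δ → List Bool → β}
    (hf : ∀ K, PolyTime fun x => f x K)
    (hl : PolyTime l) (b : ℕ) : PolyTime fun x => f x (takePad b (l x)) := by
  induction b generalizing f l with
  | zero => exact hf []
  | succ b ih =>
    refine (hl.headD.ite (ih (f := fun x K => f x (true :: K)) (fun K => hf _) hl.tail)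
      (ih (f := fun x K => f x (false :: K)) (fun K => hf _) hl.tail)).of_eq fun x => ?_
    rw [takePad]
    cases (l x).headD false <;> simp

/-! ### Dispatch on finitely many values -/

open Classical in
theorem data_eq (d : Data) : PolyTime fun x : Data => decide (x = d) := by
  have hfst : PolyTime Data.fst :=
    of_expr (.fst (.var 0)) (fun a s hs => by simp [Expr.eval, hs])
      (PolyBounded.size.mono fun d => by cases d <;> simp [esize, Data.fst, Data.size]; omega)
  have hsnd : PolyTime Data.snd :=
    of_expr (.snd (.var 0)) (fun a s hs => by simp [Expr.eval, hs])
      (PolyBounded.size.mono fun d => by cases d <;> simp [esize, Data.snd, Data.size]; omega)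
  induction d with
  | nil =>
    exact (cases (c := fun x : Data => x) (P := fun x => x ≠ Data.nil) id (fun x => Iff.rfl)
      (const false) (const true)).of_eq fun x => by by_cases h : x = Data.nil <;> simp [h]
  | cons a b iha ihb =>
    exact (cases (c := fun x : Data => x) (P := fun x => x ≠ Data.nil) id (fun x => Iff.rfl)
      ((iha.comp hfst).and (ihb.comp hsnd)) (const false)).of_eq fun x => by
        cases x <;> simp [Data.fst, Data.snd]; congr

/-- Dispatch on an element of a finite type. -/
theorem finite_dispatch {ι : Type*} [Enc ι] [Finite ι]
    (hi : Function.Injective (Enc.enc : ι → Data)) {c : δ → ι} {f : ι → δ → β} (hc : PolyTime c)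
    (hf : ∀ i, PolyTime (f i)) :
    PolyTime fun x => f (c x) x := by
  classical
  rcases isEmpty_or_nonempty ι with h | ⟨⟨i₀⟩⟩
  · exact ⟨⟨.skip, fun _ => 0, .const 0, fun x => isEmptyElim (c x)⟩, 0, fun x => isEmptyElim (c x)⟩
  have key (s : Finset ι) : PolyTime fun x => if c x ∈ s then f (c x) x else f i₀ x := by
    induction s using Finset.induction_on with
    | empty => simpa using hf i₀
    | insert i s _ ih =>
      have he : PolyTime fun x => decide (Enc.enc (c x) = Enc.enc i) :=
        (data_eq (Enc.enc i)).comp ((of_enc_eq (f := fun i : ι => Enc.enc i) fun _ => rfl).comp hc)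
      refine (he.ite (hf i) ih).of_eq fun x => ?_
      by_cases h : c x = i
      · simp [h]
      · simp [h, hi.ne h]
  have := Fintype.ofFinite ι
  simpa using key Finset.univ

theorem finite_apply {ι : Type*} [Enc ι] [Finite ι]
    (hi : Function.Injective (Enc.enc : ι → Data)) {c : δ → ι} (hc : PolyTime c) (f : ι → β) :
    PolyTime fun x => f (c x) :=
  finite_dispatch hi (f := fun i _ => f i) hc fun _ => const _

end PolyTime

theorem enc_nat_injective : Function.Injective (Enc.enc : ℕ → Data) := fun m n h => by
  have : esize m = esize n := by rw [esize, h, esize]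
  simp only [esize_nat] at this; omega

theorem enc_fin_injective {k : ℕ} : Function.Injective (Enc.enc : Fin k → Data) := fun _ _ h =>
  Fin.ext (enc_nat_injective h)

theorem enc_bool_injective : Function.Injective (Enc.enc : Bool → Data) := fun a b h => by
  cases a <;> cases b <;> simp_all

theorem enc_option_injective {ι : Type*} [Enc ι] (hi : Function.Injective (Enc.enc : ι → Data)) :
    Function.Injective (Enc.enc : Option ι → Data) := fun a b h => by
  cases a <;> cases b <;> simp_all
  exact hi h

theorem enc_prod_injective {ι κ : Type*} [Enc ι] [Enc κ]
    (hi : Function.Injective (Enc.enc : ι → Data))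
    (hk : Function.Injective (Enc.enc : κ → Data)) :
    Function.Injective (Enc.enc : ι × κ → Data) := fun a b h => by
  simp only [enc_prod, Data.cons.injEq] at h
  exact Prod.ext (hi h.1) (hk h.2)

end

/-! ### Exhaustive search -/

/-- Each written tree costs at least one step. This turns the time bound into a bound on the number
of minimal transversals. -/
theorem Exec.length_le {p : Prog} {s s' : Store} {o : List Data} {t : ℕ} (h : Exec p s o t s') :
    o.length ≤ t := by
  induction h with
  | skip | assign | emit | loop_stop => simp
  | cond_true _ _ ih | cond_false _ _ ih => omega
  | seq _ _ ih₁ ih₂ | loop_step _ _ _ ih₁ ih₂ => rw [List.length_append]; omega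

section

variable {ι σ β : Type*} [Enc ι] [Enc σ] [Enc β]

/-- Move the elements of the list in the variable `0` to the stack in the variable `1`. -/
def pushLoop : Prog :=
  .loop (.var 0) (.seq (.assign 1 (.cons (.fst (.var 0)) (.var 1))) (.assign 0 (.snd (.var 0))))

theorem exec_pushLoop (l k : List σ) (s : Store) (h0 : s 0 = Enc.enc l) (h1 : s 1 = Enc.enc k) :
    ∃ s' t, Exec pushLoop s [] t s' ∧ s' 1 = Enc.enc (l.reverse ++ k) ∧ t ≤ 20 * l.length + 2 := by
  induction l generalizing k s with
  | nil => exact ⟨s, _, Exec.loop_stop (by simp [Expr.eval, h0]), by simp [h1], by simp [Expr.cost]⟩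
  | cons a l ih =>
    have e1 := Exec.assign 1 (.cons (.fst (.var 0)) (.var 1)) s
    have e2 := Exec.assign 0 (.snd (.var 0)) (Function.update s 1
      ((Expr.cons (.fst (.var 0)) (.var 1)).eval s))
    obtain ⟨s', t, h2, h3, h4⟩ := ih (a :: k)
      (Function.update (Function.update s 1 ((Expr.cons (.fst (.var 0)) (.var 1)).eval s)) 0
        ((Expr.snd (.var 0)).eval
          (Function.update s 1 ((Expr.cons (.fst (.var 0)) (.var 1)).eval s))))
      (by simp [Expr.eval, h0, Data.snd])
      (by simp [Expr.eval, h0, h1, Data.fst])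
    refine ⟨s', _, Exec.loop_step (o₁ := []) (o₂ := []) (by simp [Expr.eval, h0])
      (Exec.seq e1 e2) h2, by simpa using h3, ?_⟩
    simp only [Expr.cost, List.length_cons]; omega

/-- One round of the search: take a node from the stack, replace it by its children, and write
its output, if there is one. -/
def searchBody (p : Prog) : Prog :=
  .seq (.assign 0 (.fst (.var 1))) <| .seq (.assign 1 (.snd (.var 1))) <| .seq p <|
  .seq (.cond (.fst (.var 0)) (.emit (.fst (.fst (.var 0)))) .skip) <|
  .seq (.assign 0 (.snd (.var 0))) pushLoop

theorem exec_searchBody {p : Prog} {step : σ → Option β × List σ} {x : σ} {T : ℕ}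
    (hp : Computes p (Enc.enc x) (Enc.enc (step x)) T) (k : List σ) (s : Store)
    (hs : s 1 = Enc.enc (x :: k)) :
    ∃ s' t, Exec (searchBody p) s ((step x).1.toList.map Enc.enc) t s' ∧
      s' 1 = Enc.enc ((step x).2.reverse ++ k) ∧ t ≤ T + 21 * esize (step x) + 50 := by
  set s1 := Function.update s 0 ((Expr.fst (.var 1)).eval s) with hs1
  set s2 := Function.update s1 1 ((Expr.snd (.var 1)).eval s1) with hs2
  obtain ⟨s3, t, h1, h2, h3, h4⟩ := hp s2 (by simp [hs2, hs1, Expr.eval, hs, Data.fst])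
  have h31 : s3 1 = Enc.enc k := by rw [h3]; simp [hs2, hs1, Expr.eval, hs, Data.snd]
  obtain ⟨s5, t5, k1, k2, k3⟩ := exec_pushLoop (step x).2 k
    (Function.update s3 0 ((Expr.snd (.var 0)).eval s3)) (by simp [Expr.eval, h2, Data.snd])
    (by simp [h31])
  have e1 := Exec.assign 0 (.fst (.var 1)) s
  have e2 := Exec.assign 1 (.snd (.var 1)) s1
  have e5 := Exec.assign 0 (.snd (.var 0)) s3
  have e4 : ∃ t, Exec (.cond (.fst (.var 0)) (.emit (.fst (.fst (.var 0)))) .skip) s3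
      ((step x).1.toList.map Enc.enc) t s3 ∧ t ≤ esize (step x).1 + 10 := by
    cases h : (step x).1 with
    | none =>
      exact ⟨_, Exec.cond_false (by simp [Expr.eval, h2, h, Data.fst]) (Exec.skip s3),
        by simp [Expr.cost]⟩
    | some S =>
      have he : (Expr.fst (.fst (.var 0))).eval s3 = Enc.enc S := by
        simp [Expr.eval, h2, h, Data.fst]
      have := Exec.emit (.fst (.fst (.var 0))) s3
      rw [he] at this
      refine ⟨_, Exec.cond_true (by simp [Expr.eval, h2, h, Data.fst]) this, ?_⟩
      simp only [Expr.cost, esize_some]; simp only [esize]; omega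
  obtain ⟨t4, e4, ht4⟩ := e4
  have e := Exec.seq e1 (Exec.seq e2 (Exec.seq h1 (Exec.seq e4 (Exec.seq e5 k1))))
  simp only [List.nil_append, List.append_nil] at e
  refine ⟨s5, _, e, k2, ?_⟩
  have h6 := length_le_esize (step x).2
  have h7 : esize (step x) = esize (step x).1 + esize (step x).2 + 1 := rfl
  simp only [Expr.cost]; omega

/-- What is needed to know about a search tree: `Inv` holds at its nodes, `Φ` bounds the number of
nodes below a node, and `Spec` gives the outputs below a node, which are produced once each. -/
structure SearchTree (step : σ → Option β × List σ) (Inv : σ → Prop) (Φ : σ → ℕ)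
    (Spec : σ → Set β) : Prop where
  inv : ∀ x, Inv x → ∀ y ∈ (step x).2, Inv y
  potential : ∀ x, Inv x → 1 + ((step x).2.map Φ).sum ≤ Φ x
  mem_spec : ∀ x, Inv x → ∀ S, S ∈ Spec x ↔ (step x).1 = some S ∨ ∃ y ∈ (step x).2, S ∈ Spec y
  pairwise : ∀ x, Inv x → (step x).2.Pairwise fun y z => Disjoint (Spec y) (Spec z)
  output : ∀ x, Inv x → ∀ S, (step x).1 = some S → ∀ y ∈ (step x).2, S ∉ Spec y

/-- Induction on a bound for the total potential of the stack: a round replaces a node by children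
whose potentials sum to at least one less. The sets below distinct stack entries stay disjoint, so
no output is repeated. -/
theorem SearchTree.exec_loop {step : σ → Option β × List σ} {Inv : σ → Prop} {Φ : σ → ℕ}
    {Spec : σ → Set β} (H : SearchTree step Inv Φ Spec) {p : Prog} {D : ℕ}
    (hp : ∀ x, Inv x → ∃ T, Computes p (Enc.enc x) (Enc.enc (step x)) T ∧
      T + 21 * esize (step x) + 52 ≤ D) (N : ℕ) (k : List σ) (hk : ∀ x ∈ k, Inv x)
    (hN : (k.map Φ).sum ≤ N) (hd : k.Pairwise fun y z => Disjoint (Spec y) (Spec z)) (s : Store)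
    (hs : s 1 = Enc.enc k) :
    ∃ (out : List β) (s' : Store) (t : ℕ),
      Exec (.loop (.var 1) (searchBody p)) s (out.map Enc.enc) t s' ∧ out.Nodup ∧
      (∀ S, S ∈ out ↔ ∃ x ∈ k, S ∈ Spec x) ∧ t ≤ N * D + 2 := by
  induction N generalizing k s with
  | zero =>
    cases k with
    | nil =>
      exact ⟨[], s, _, Exec.loop_stop (by simp [Expr.eval, hs]), by simp, by simp,
        by simp [Expr.cost]⟩
    | cons x k =>
      have := H.potential x (hk x (by simp))
      simp only [List.map_cons, List.sum_cons] at hN; omega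
  | succ N ih =>
    cases k with
    | nil =>
      exact ⟨[], s, _, Exec.loop_stop (by simp [Expr.eval, hs]), by simp, by simp,
        by simp [Expr.cost]⟩
    | cons x k =>
      have hx := hk x (by simp)
      obtain ⟨T, hT, hTD⟩ := hp x hx
      obtain ⟨s1, t1, e1, hs1, ht1⟩ := exec_searchBody hT k s hs
      rw [List.pairwise_cons] at hd
      have hsub : ∀ y ∈ (step x).2, Spec y ⊆ Spec x := fun y hy S hS =>
        (H.mem_spec x hx S).2 (Or.inr ⟨y, hy, hS⟩)
      obtain ⟨out, s2, t2, e2, hnd, hmem, ht2⟩ := ih ((step x).2.reverse ++ k)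
        (fun y hy => by
          rcases List.mem_append.1 hy with hy | hy
          · exact H.inv x hx y (List.mem_reverse.1 hy)
          · exact hk y (by simp [hy]))
        (by
          have := H.potential x hx
          simp only [List.map_cons, List.sum_cons] at hN
          simp only [List.map_append, List.sum_append, List.map_reverse, List.sum_reverse]; omega)
        (List.pairwise_append.2 ⟨List.pairwise_reverse.2
          ((H.pairwise x hx).imp fun h => h.symm), hd.2, fun y hy z hz =>
            (hd.1 z hz).mono_left (hsub y (List.mem_reverse.1 hy))⟩) s1 hs1
      have e := Exec.loop_step (e := .var 1) (by simp [Expr.eval, hs]) e1 e2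
      rw [← List.map_append] at e
      refine ⟨(step x).1.toList ++ out, s2, _, e, ?_, fun S => ?_, ?_⟩
      · refine List.nodup_append'.2 ⟨by cases (step x).1 <;> simp, hnd, fun S hS hS' => ?_⟩
        have hS : (step x).1 = some S := by simpa using hS
        obtain ⟨y, hy, hSy⟩ := (hmem S).1 hS'
        rcases List.mem_append.1 hy with hy | hy
        · exact H.output x hx S hS y (List.mem_reverse.1 hy) hSy
        · exact Set.disjoint_left.1 (hd.1 y hy) ((H.mem_spec x hx S).2 (Or.inl hS)) hSy
      · have h1 : (∃ y ∈ (step x).2.reverse ++ k, S ∈ Spec y) ↔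
            (∃ y ∈ (step x).2, S ∈ Spec y) ∨ ∃ y ∈ k, S ∈ Spec y := by
          simp [or_and_right, exists_or]
        rw [List.mem_append, hmem, h1, List.exists_mem_cons_iff, H.mem_spec x hx S, ← or_assoc]
        simp
      · simp only [Expr.cost, add_mul]; omega

/-- A search with polynomial-time steps can be carried out in time linear in the size of the search
tree and polynomial in the size of its nodes. -/
theorem exists_search {start : ι → σ} {step : σ → Option β × List σ} (hstart : PolyTime start)
    (hstep : PolyTime step) :
    ∃ (p : Prog) (c : ℕ), ∀ (i : ι) (Inv : σ → Prop) (Φ : σ → ℕ) (Spec : σ → Set β) (B : ℕ),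
      SearchTree step Inv Φ Spec → Inv (start i) → (∀ x, Inv x → esize x ≤ B) → esize i ≤ B →
      ∃ (out : List β) (t : ℕ), out.Nodup ∧ (∀ S, S ∈ out ↔ S ∈ Spec (start i)) ∧
        t ≤ (B + 1) ^ c * (Φ (start i) + 1) ∧ p.Runs (Enc.enc i) (out.map Enc.enc) t := by
  obtain ⟨⟨q, S, ⟨b, hb⟩, hq⟩, -⟩ := hstart
  obtain ⟨⟨p, T, ⟨c, hc⟩, hp⟩, ⟨d, hd⟩⟩ := hstep
  refine ⟨.seq q (.seq (.assign 1 (.cons (.var 0) .nil)) (.loop (.var 1) (searchBody p))),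
    b + c + d + 80, fun i Inv Φ Spec B H hi hB hiB => ?_⟩
  obtain ⟨s1, t1, e1, h0, -, ht1⟩ := hq i (Function.update (fun _ => Data.nil) 0 (Enc.enc i))
    (by simp)
  have e2 := Exec.assign 1 (.cons (.var 0) .nil) s1
  obtain ⟨out, s3, t3, e3, hnd, hmem, ht3⟩ := H.exec_loop (p := p)
    (D := (B + 1) ^ c + 21 * (B + 1) ^ d + 52)
    (fun x hx => ⟨T x, hp x, by
      have h1 := (hc x).trans (Nat.pow_le_pow_left (Nat.succ_le_succ (hB x hx)) c)
      have h2 := (hd x).trans (Nat.pow_le_pow_left (Nat.succ_le_succ (hB x hx)) d)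
      dsimp only [Nat.succ_eq_add_one] at h1 h2
      omega⟩) (Φ (start i)) [start i] (by simpa using hi) (by simp) (by simp)
    (Function.update s1 1 ((Expr.cons (.var 0) .nil).eval s1)) (by simp [Expr.eval, h0])
  have e := Exec.seq e1 (Exec.seq e2 e3)
  simp only [List.nil_append] at e
  refine ⟨out, _, hnd, by simpa using hmem, ?_, s3, e⟩
  have hB1 : 2 ≤ B + 1 := by have := esize_pos i; omega
  have hM (m : ℕ) (hm : m ≤ b + c + d) : (B + 1) ^ m ≤ (B + 1) ^ (b + c + d) :=
    Nat.pow_le_pow_right (by omega) hm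
  have h1 := hM b (by omega)
  have h2 := hM c (by omega)
  have h3 := hM d (by omega)
  have h4 : 1 ≤ (B + 1) ^ (b + c + d) := Nat.one_le_pow _ _ (by omega)
  have h5 : t1 ≤ (B + 1) ^ b := ht1.trans ((hb i).trans (Nat.pow_le_pow_left (by omega) b))
  -- The extra 80 in the exponent only serves to absorb the constant factor 100.
  have h6 : (2 : ℕ) ^ 80 ≤ (B + 1) ^ 80 := Nat.pow_le_pow_left hB1 80
  have h7 : Φ (start i) * ((B + 1) ^ c + 21 * (B + 1) ^ d + 52) ≤
      Φ (start i) * (100 * (B + 1) ^ (b + c + d)) := Nat.mul_le_mul_left _ (by omega)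
  calc _ ≤ 100 * (B + 1) ^ (b + c + d) * (Φ (start i) + 1) := by
        simp only [Expr.cost]
        have : 100 * (B + 1) ^ (b + c + d) * (Φ (start i) + 1) =
          Φ (start i) * (100 * (B + 1) ^ (b + c + d)) + 100 * (B + 1) ^ (b + c + d) := by ring
        omega
    _ ≤ _ := by
        rw [pow_add (B + 1) (b + c + d) 80, mul_comm ((B + 1) ^ (b + c + d))]
        gcongr
        omega

end

end TreeMachine

namespace TransversalEnumeration

open TreeMachine

/-! ### Weighted covers -/

/-- The greedy bound for weighted set cover: a fractional cover of cost `W` gives a cover whose cost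
exceeds `W` by a harmonic factor. -/
theorem exists_cover {P κ : Type*} [DecidableEq P] [DecidableEq κ] (s : Finset P) (p c : P → ℝ)
    (hp : ∀ x ∈ s, 0 ≤ p x) (hc : ∀ x ∈ s, 0 < c x) (cov : P → κ → Prop)
    [∀ x k, Decidable (cov x k)] {W : ℝ} (hW : ∑ x ∈ s, p x * c x ≤ W) (U : Finset κ)
    (hU : ∀ k ∈ U, 1 ≤ ∑ x ∈ s with cov x k, p x) :
    ∃ L ⊆ s, (∀ k ∈ U, ∃ x ∈ L, cov x k) ∧
      ∑ x ∈ L, c x ≤ W * ∑ i ∈ Finset.range U.card, (1 : ℝ) / (i + 1) := by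
  have hW0 : 0 ≤ W := (Finset.sum_nonneg fun x hx => mul_nonneg (hp x hx) (hc x hx).le).trans hW
  induction hn : U.card using Nat.strong_induction_on generalizing U with
  | _ n ih =>
  rcases U.eq_empty_or_nonempty with rfl | ⟨k₀, hk₀⟩
  · refine ⟨∅, by simp, by simp, ?_⟩
    simp only [Finset.sum_empty]
    exact mul_nonneg hW0 (Finset.sum_nonneg fun i _ => by positivity)
  have hn0 : 0 < n := hn ▸ Finset.card_pos.2 ⟨k₀, hk₀⟩
  -- The greedy choice: some `x` costs at most `W / n` per element that it covers. Otherwise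
  -- averaging with the weights `p` would give a fractional cover of cost more than `W`.
  obtain ⟨x, hx, hxU⟩ : ∃ x ∈ s, c x * n ≤ W * (U.filter (cov x)).card := by
    by_contra! hlt
    have h1 : ∑ x ∈ s, p x * (W * (U.filter (cov x)).card) < ∑ x ∈ s, p x * (c x * n) := by
      refine Finset.sum_lt_sum (fun x hx => mul_le_mul_of_nonneg_left (hlt x hx).le (hp x hx)) ?_
      obtain ⟨x, hx, hpx⟩ : ∃ x ∈ s.filter (cov · k₀), 0 < p x := by
        by_contra! h
        have := (hU k₀ hk₀).trans (Finset.sum_nonpos h)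
        linarith
      exact ⟨x, (Finset.mem_filter.1 hx).1,
        mul_lt_mul_of_pos_left (hlt x (Finset.mem_filter.1 hx).1) hpx⟩
    have h2 : ∑ x ∈ s, p x * (c x * n) ≤ W * n := by
      simp_rw [← mul_assoc]
      rw [← Finset.sum_mul]
      gcongr
    have h3 : W * n ≤ ∑ x ∈ s, p x * (W * (U.filter (cov x)).card) := by
      have e : ∑ x ∈ s, p x * (W * (U.filter (cov x)).card) =
          W * ∑ k ∈ U, ∑ x ∈ s with cov x k, p x := by
        simp_rw [Finset.sum_filter, Finset.card_filter, Nat.cast_sum, Finset.mul_sum]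
        rw [Finset.sum_comm]
        refine Finset.sum_congr rfl fun k _ => Finset.sum_congr rfl fun x _ => ?_
        split_ifs <;> push_cast <;> ring
      rw [e]
      refine mul_le_mul_of_nonneg_left ?_ hW0
      calc (n : ℝ) = ∑ k ∈ U, (1 : ℝ) := by simp [hn]
        _ ≤ _ := Finset.sum_le_sum hU
    linarith
  set m := (U.filter (cov x)).card with hm
  have hm0 : 0 < m := by
    rcases Nat.eq_zero_or_pos m with h | h
    · rw [h] at hxU
      have : 0 < c x * n := mul_pos (hc x hx) (by exact_mod_cast hn0)
      simp at hxU; linarith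
    · exact h
  have hsplit : m + (U.filter fun k => ¬ cov x k).card = n := by
    rw [hm, ← hn]; exact Finset.card_filter_add_card_filter_not _
  obtain ⟨L, hL, hcov, hcost⟩ := ih (U.filter fun k => ¬ cov x k).card (by omega)
    (U.filter fun k => ¬ cov x k) (fun k hk => hU k (Finset.mem_filter.1 hk).1) rfl
  refine ⟨insert x L, Finset.insert_subset hx hL, fun k hk => ?_, ?_⟩
  · by_cases h : cov x k
    · exact ⟨x, by simp, h⟩
    · obtain ⟨y, hy, hyk⟩ := hcov k (by simp [hk, h])
      exact ⟨y, by simp [hy], hyk⟩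
  · set r := (U.filter fun k => ¬ cov x k).card with hr
    have h1 : ∑ y ∈ insert x L, c y ≤ c x + ∑ y ∈ L, c y := by
      by_cases hxL : x ∈ L
      · rw [Finset.insert_eq_of_mem hxL]; linarith [hc x hx]
      · rw [Finset.sum_insert hxL]
    have h2 : c x ≤ W * (m / n) := by
      rw [← mul_div_assoc, le_div_iff₀ (by exact_mod_cast hn0)]; exact hxU
    -- Passing from `n` uncovered elements to `r = n - m` uses up the harmonic terms `1 / (r + 1),
    -- …, 1 / n`, each of which is at least `1 / n`.
    have h3 : (m : ℝ) / n ≤ ∑ i ∈ Finset.Ico r n, (1 : ℝ) / (i + 1) := by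
      have : ∑ i ∈ Finset.Ico r n, (1 : ℝ) / n ≤ ∑ i ∈ Finset.Ico r n, (1 : ℝ) / (i + 1) := by
        refine Finset.sum_le_sum fun i hi => one_div_le_one_div_of_le (by positivity) ?_
        exact_mod_cast (Finset.mem_Ico.1 hi).2
      refine le_trans (le_of_eq ?_) this
      rw [Finset.sum_const, Nat.card_Ico, show n - r = m by omega, nsmul_eq_mul]; ring
    have h4 := Finset.sum_range_add_sum_Ico (fun i : ℕ => (1 : ℝ) / (i + 1)) (show r ≤ n by omega)
    calc _ ≤ W * (m / n) + W * ∑ i ∈ Finset.range r, (1 : ℝ) / (i + 1) := by linarith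
      _ ≤ _ := by
        rw [← mul_add, ← h4]
        exact mul_le_mul_of_nonneg_left (by linarith) hW0

theorem sum_one_div_le (b : ℕ) : ∑ i ∈ Finset.range (2 ^ b), (1 : ℝ) / (i + 1) ≤ b + 1 := by
  have h := harmonic_le_one_add_log (2 ^ b)
  have e : ((harmonic (2 ^ b) : ℚ) : ℝ) = ∑ i ∈ Finset.range (2 ^ b), (1 : ℝ) / (i + 1) := by
    simp [harmonic]
  rw [e] at h
  push_cast at h
  rw [Real.log_pow] at h
  have := Real.log_two_lt_d9
  have hb : (b : ℝ) * Real.log 2 ≤ b * 1 := mul_le_mul_of_nonneg_left (by linarith) (by positivity)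
  linarith

/-- Every subset `K` of a `b`-element set is represented by one of few pairs `(A, j)` with
`A ⊆ K` and `|K \ A| = j`. -/
theorem exists_finset_cover (b : ℕ) : ∃ L : Finset (Finset (Fin b) × ℕ),
    (∀ K : Finset (Fin b), ∃ x ∈ L, x.1 ⊆ K ∧ (K \ x.1).card = x.2) ∧
    ∑ x ∈ L, (5 : ℝ) ^ x.2 ≤ (b + 1) ^ 2 * (9 / 5) ^ b := by
  classical
  -- The factor `(1/5)^j` cancels the cost `5 ^ j`. What remains is `b + 1` copies of `∑ A,
  -- (4/5)^|A| = (1 + 4/5)^b`.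
  have hW : ∑ x ∈ (Finset.univ : Finset (Finset (Fin b))) ×ˢ Finset.range (b + 1),
      ((4 / 5 : ℝ) ^ x.1.card * (1 / 5) ^ x.2) * 5 ^ x.2 ≤ (b + 1) * (9 / 5) ^ b := by
    rw [Finset.sum_product]
    have (A : Finset (Fin b)) (j : ℕ) : ((4 / 5 : ℝ) ^ A.card * (1 / 5) ^ j) * 5 ^ j =
        (4 / 5 : ℝ) ^ A.card * 1 ^ (Fintype.card (Fin b) - A.card) := by
      rw [mul_assoc, ← mul_pow]; norm_num
    simp_rw [this, Finset.sum_const, Finset.card_range, ← Finset.smul_sum]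
    rw [Fintype.sum_pow_mul_eq_add_pow]
    simp; norm_num
  obtain ⟨L, -, hcov, hcost⟩ := exists_cover
    ((Finset.univ : Finset (Finset (Fin b))) ×ˢ Finset.range (b + 1))
    (fun x => (4 / 5 : ℝ) ^ x.1.card * (1 / 5) ^ x.2) (fun x => 5 ^ x.2)
    (fun x _ => by positivity) (fun x _ => by positivity)
    (fun x K => x.1 ⊆ K ∧ (K \ x.1).card = x.2) hW Finset.univ fun K _ => by
      rw [Finset.sum_filter, Finset.sum_product]
      -- The binomial theorem for `(4/5 + 1/5)^|K|`: the weights of the pairs that represent `K` sum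
      -- to 1.
      have e : (1 : ℝ) = ∑ A ∈ K.powerset, (4 / 5 : ℝ) ^ A.card * (1 / 5) ^ (K.card - A.card) := by
        rw [Finset.sum_pow_mul_eq_add_pow, show (4 / 5 + 1 / 5 : ℝ) = 1 by norm_num, one_pow]
      refine e.le.trans ?_
      rw [← Finset.sum_filter_add_sum_filter_not Finset.univ (fun A => A ⊆ K)]
      refine le_trans (le_of_eq ?_) (le_add_of_nonneg_right (Finset.sum_nonneg fun A _ =>
        Finset.sum_nonneg fun j _ => by positivity))
      have hK : K.powerset = Finset.univ.filter (fun A => A ⊆ K) := by ext; simp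
      rw [hK]
      refine Finset.sum_congr rfl fun A hA => ?_
      have hA : A ⊆ K := (Finset.mem_filter.1 hA).2
      rw [Finset.sum_eq_single_of_mem (K.card - A.card)]
      · simp [hA, Finset.card_sdiff_of_subset hA]
      · have := Finset.card_le_univ K
        simp at this ⊢; omega
      · intro j _ hj
        rw [if_neg]
        rintro ⟨-, h⟩
        rw [Finset.card_sdiff_of_subset hA] at h
        exact hj h.symm
  refine ⟨L, fun K => hcov K (Finset.mem_univ K), hcost.trans ?_⟩
  have h := sum_one_div_le b
  have hb : (Finset.univ : Finset (Finset (Fin b))).card = 2 ^ b := by simp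
  rw [hb]
  calc _ ≤ ((b : ℝ) + 1) * (9 / 5) ^ b * (b + 1) := mul_le_mul_of_nonneg_left h (by positivity)
    _ = _ := by ring

/-- Any base strictly between `9/5` and `1.8863` would do. The summand 1 pays for the guessing node
itself in the recursion over the blocks. -/
theorem exists_block_size : ∃ b : ℕ, 0 < b ∧ ((b : ℝ) + 1) ^ 2 * (9 / 5) ^ b + 1 ≤ 1.88 ^ b := by
  have h := isLittleO_pow_const_mul_const_pow_const_pow_of_norm_lt (R := ℝ) 2
    (r₁ := 9 / 5) (r₂ := 1.88) (by norm_num)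
  -- With `(b + 1) ^ 2 ≤ 4 * b ^ 2`, the constant `1/8` makes the main term at most half of `1.88 ^
  -- b`; for `b ≥ 2` the other half is at least 1.
  obtain ⟨b, hb, hb2⟩ := ((h.def (show (0 : ℝ) < 1 / 8 by norm_num)).and
    (eventually_ge_atTop 2)).exists
  refine ⟨b, by omega, ?_⟩
  rw [Real.norm_of_nonneg (by positivity), Real.norm_of_nonneg (by positivity)] at hb
  have hb2' : (2 : ℝ) ≤ b := by exact_mod_cast hb2
  have h1 : ((b : ℝ) + 1) ^ 2 ≤ 4 * b ^ 2 := by nlinarith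
  have h2 : ((b : ℝ) + 1) ^ 2 * (9 / 5) ^ b ≤ 4 * b ^ 2 * (9 / 5) ^ b := by gcongr
  have h3 : (1.88 : ℝ) ^ 2 ≤ 1.88 ^ b := pow_le_pow_right₀ (by norm_num) hb2
  norm_num at h3 hb ⊢
  linarith

/-! ### Partial vectors -/

/-- `S` agrees with the partial vector `T`. -/
def Agrees : List (Option Bool) → List Bool → Prop
  | t :: T, s :: S => (∀ c, t = some c → c = s) ∧ Agrees T S
  | _, _ => True

/-- The number of elements of `S` that `T` does not put in. -/
def extra : List (Option Bool) → List Bool → ℕ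
  | t :: T, s :: S => (if s = true ∧ t ≠ some true then 1 else 0) + extra T S
  | _, _ => 0

@[simp] theorem agrees_nil_left (S : List Bool) : Agrees [] S := by simp [Agrees]
@[simp] theorem agrees_nil_right (T : List (Option Bool)) : Agrees T [] := by simp [Agrees]
@[simp] theorem agrees_cons (t : Option Bool) (T : List (Option Bool)) (s : Bool) (S : List Bool) :
    Agrees (t :: T) (s :: S) ↔ (∀ c, t = some c → c = s) ∧ Agrees T S := Iff.rfl
@[simp] theorem extra_nil_left (S : List Bool) : extra [] S = 0 := by simp [extra]
@[simp] theorem extra_nil_right (T : List (Option Bool)) : extra T [] = 0 := by simp [extra]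
@[simp] theorem extra_cons (t : Option Bool) (T : List (Option Bool)) (s : Bool) (S : List Bool) :
    extra (t :: T) (s :: S) = (if s = true ∧ t ≠ some true then 1 else 0) + extra T S := rfl

theorem agrees_ofFn {b : ℕ} (f : Fin b → Option Bool) (g : Fin b → Bool) :
    Agrees (List.ofFn f) (List.ofFn g) ↔ ∀ i c, f i = some c → c = g i := by
  induction b with
  | zero => simp
  | succ b ih => simp [List.ofFn_succ, ih, Fin.forall_fin_succ]

theorem extra_ofFn {b : ℕ} (f : Fin b → Option Bool) (g : Fin b → Bool) :
    extra (List.ofFn f) (List.ofFn g) =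
      (Finset.univ.filter fun i => g i = true ∧ f i ≠ some true).card := by
  rw [Finset.card_filter]
  induction b with
  | zero => simp
  | succ b ih => rw [List.ofFn_succ, List.ofFn_succ, extra_cons, ih, Fin.sum_univ_succ]

/-- A table of guesses for the blocks of `b` vertices: the guess `g` stands for sets that
contain the vertices in `X g` and at most `j g` others, and `canon K` is the guess for the
set `K`. -/
structure BlockTable (b k : ℕ) where
  X : Fin k → List (Option Bool)
  j : Fin k → ℕ
  canon : List Bool → Fin k
  length_X : ∀ g, (X g).length = b
  agrees : ∀ K, K.length = b → Agrees (X (canon K)) K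
  extra_le : ∀ K, K.length = b → extra (X (canon K)) K ≤ j (canon K)

/-- The bound for the number of nodes that a block contributes to the search tree. -/
def BlockTable.cost {b k : ℕ} (τ : BlockTable b k) : ℕ := ∑ g, 5 ^ τ.j g

/-- The cover may represent a set by several pairs. Choosing one of them for each set defines
`canon`, which later rules out duplicate outputs. -/
theorem exists_blockTable : ∃ (b k : ℕ) (τ : BlockTable b k),
    0 < b ∧ (τ.cost : ℝ) + 1 ≤ 1.88 ^ b := by
  classical
  obtain ⟨b, hb0, hb⟩ := exists_block_size
  obtain ⟨L, hcov, hcost⟩ := exists_finset_cover b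
  choose f hfL hf using hcov
  let e := L.equivFin
  let set (K : List Bool) : Finset (Fin b) := Finset.univ.filter fun i => K.getD i false = true
  have hK (K : List Bool) (h : K.length = b) : K = List.ofFn fun i : Fin b => K.getD i false := by
    apply List.ext_getElem <;> simp_all
  have hX (K : List Bool) : ((e.symm (e ⟨f (set K), hfL (set K)⟩)).1).1 = (f (set K)).1 := by simp
  refine ⟨b, L.card, {
    X := fun g => List.ofFn fun i : Fin b => if i ∈ (e.symm g).1.1 then some true else none
    j := fun g => (e.symm g).1.2
    canon := fun K => e ⟨f (set K), hfL (set K)⟩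
    length_X := fun g => by simp
    agrees := fun K h => ?_
    extra_le := fun K h => ?_ }, hb0, ?_⟩
  · rw [hK K h, agrees_ofFn, ← hK K h]
    intro i c hc
    rw [hX] at hc
    split_ifs at hc with hi
    have := (hf (set K)).1 hi
    simp only [set, Finset.mem_filter, Finset.mem_univ, true_and] at this
    rw [this]
    simpa using hc.symm
  · conv_lhs => rw [hK K h, extra_ofFn, ← hK K h]
    simp only [Equiv.symm_apply_apply]
    rw [← (hf (set K)).2]
    refine Finset.card_le_card fun i hi => ?_
    simpa [set] using hi
  · have : ((∑ g, 5 ^ (e.symm g).1.2 : ℕ) : ℝ) = ∑ x ∈ L, (5 : ℝ) ^ x.2 := by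
      push_cast
      rw [Equiv.sum_comp e.symm (fun x : L => (5 : ℝ) ^ x.1.2)]
      exact Finset.sum_coe_sort L fun x => (5 : ℝ) ^ x.2
    simp only [BlockTable.cost]
    rw [this]
    linarith

/-! ### Characteristic vectors -/

/-- Do the sets with characteristic vectors `e` and `S` intersect? -/
def hit (e S : List Bool) : Bool := (e.zip S).any fun p => p.1 && p.2

/-- The sets that arise from `S` by the removal of one element. -/
def removals : List Bool → List (List Bool)
  | [] => []
  | s :: S => if s = true then (false :: S) :: (removals S).map fun r => s :: r
    else (removals S).map fun r => s :: r

def isTransversal (E : List (List Bool)) (S : List Bool) : Bool := E.all fun e => hit e S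

def isMinimalTransversal (E : List (List Bool)) (S : List Bool) : Bool :=
  isTransversal E S && (removals S).all fun r => !isTransversal E r

/-- The set of vertices that a partial vector puts in. -/
def inBits (T : List (Option Bool)) : List Bool := T.map fun t => decide (t = some true)

/-- One step of `setLast`. -/
def setLastStep (c : Option Bool) (p : Bool × Option Bool) (acc : Bool × List (Option Bool)) :
    Bool × List (Option Bool) :=
  if (!acc.1 && decide (p = (true, none))) = true then (true, c :: acc.2) else (acc.1, p.2 :: acc.2)

/-- Set the last undecided vertex of `e` to `c`. The first component tells whether there is one. -/
def setLast (c : Option Bool) (e : List Bool) (T : List (Option Bool)) :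
    Bool × List (Option Bool) :=
  (e.zip T).foldr (setLastStep c) (false, [])

/-- Are the guesses `gs` those that the table prescribes for the set `S`? -/
def accepts {b k : ℕ} (τ : BlockTable b k) : List (Fin k) → List Bool → Bool
  | [], _ => true
  | g :: gs, S => decide (τ.canon (takePad b S) = g) && accepts τ gs (S.drop b)

theorem length_of_mem_removals {S r : List Bool} (h : r ∈ removals S) : r.length = S.length := by
  induction S generalizing r with
  | nil => simp [removals] at h
  | cons s S ih => cases s <;> simp [removals] at h <;> grind

theorem length_removals_le (S : List Bool) : (removals S).length ≤ S.length := by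
  induction S with
  | nil => simp [removals]
  | cons s S ih => cases s <;> simp [removals] <;> omega

theorem esize_bits_le (S : List Bool) : esize S ≤ S.length * 4 + 1 :=
  esize_list_le fun b _ => esize_bool b

theorem esize_optionBool_le (t : Option Bool) : esize t ≤ 5 := by
  rcases t with _ | b
  · simp
  · have := esize_bool b
    simp only [esize_some]; omega

theorem esize_removals_le (S : List Bool) :
    esize (removals S) ≤ S.length * (S.length * 4 + 2) + 1 := by
  refine (esize_list_le (B := S.length * 4 + 1) fun r hr => ?_).trans ?_
  · rw [← length_of_mem_removals hr]
    exact esize_bits_le r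
  · have := Nat.mul_le_mul_right (S.length * 4 + 1 + 1) (length_removals_le S)
    exact Nat.succ_le_succ this

theorem length_foldr_setLastStep (c : Option Bool) (l : List (Bool × Option Bool)) :
    (l.foldr (setLastStep c) (false, [])).2.length = l.length := by
  induction l with
  | nil => rfl
  | cons p l ih =>
    rw [List.foldr_cons, setLastStep]
    split <;> simp [ih]

/-! ### Polynomial-time computability of the vector operations -/

section PolyTime

variable {δ : Type*} [Enc δ]

theorem polyTime_hit {e S : δ → List Bool} (he : PolyTime e) (hS : PolyTime S) :
    PolyTime fun x => hit (e x) (S x) :=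
  (he.zip hS).any (f := fun y : δ × (Bool × Bool) => y.2.1 && y.2.2)
    ((PolyTime.fst.comp .snd).and (PolyTime.snd.comp .snd))

theorem polyTime_isTransversal {E : δ → List (List Bool)} {S : δ → List Bool} (hE : PolyTime E)
    (hS : PolyTime S) : PolyTime fun x => isTransversal (E x) (S x) :=
  hE.all (f := fun y : δ × List Bool => hit y.2 (S y.1)) (polyTime_hit .snd (hS.comp .fst))

theorem polyTime_removals {S : δ → List Bool} (hS : PolyTime S) :
    PolyTime fun x => removals (S x) := by
  let f : (δ × (List Bool × List (List Bool))) × Bool → List Bool × List (List Bool) := fun y =>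
    (y.2 :: y.1.2.1, if y.2 = true then (false :: y.1.2.1) :: (y.1.2.2.map fun r => y.2 :: r)
      else y.1.2.2.map fun r => y.2 :: r)
  have e (x : δ) (l : List Bool) :
      l.foldr (fun a b => f ((x, b), a)) ([], []) = (l, removals l) := by
    induction l with
    | nil => rfl
    | cons s S ih => rw [List.foldr_cons, ih]; rfl
  have hmap : PolyTime fun y : (δ × (List Bool × List (List Bool))) × Bool =>
      y.1.2.2.map fun r => y.2 :: r :=
    PolyTime.map (f := fun z : ((δ × (List Bool × List (List Bool))) × Bool) × List Bool =>
      z.1.2 :: z.2) (PolyTime.snd.comp (PolyTime.snd.comp .fst))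
      ((PolyTime.snd.comp .fst).cons .snd)
  have h1 : PolyTime fun y : (δ × (List Bool × List (List Bool))) × Bool => y.1.2.1 :=
    PolyTime.fst.comp (PolyTime.snd.comp .fst)
  have hf : PolyTime f := (PolyTime.snd.cons h1).pair
    (PolyTime.ite (c := fun y => y.2) .snd (((PolyTime.const false).cons h1).cons hmap) hmap)
  have hB : PolyBounded fun x => esize (S x) + (esize (S x) * (esize (S x) * 4 + 2) + 1) + 1 :=
    (hS.2.add ((hS.2.mul ((hS.2.mul (.const 4)).add (.const 2))).add (.const 1))).add (.const 1)
  refine (PolyTime.snd.comp (PolyTime.foldr hS (.const ([], [])) hf hB fun x l' h => ?_)).of_eq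
    fun x => by rw [e]
  rw [e]
  have h1 := esize_sublist h.sublist
  have h2 := length_le_esize l'
  have h3 := esize_removals_le l'
  have h4 : l'.length * (l'.length * 4 + 2) ≤ esize (S x) * (esize (S x) * 4 + 2) :=
    Nat.mul_le_mul (by omega) (by omega)
  simp only [esize_prod]; omega

theorem polyTime_isMinimalTransversal {E : δ → List (List Bool)} {S : δ → List Bool}
    (hE : PolyTime E) (hS : PolyTime S) : PolyTime fun x => isMinimalTransversal (E x) (S x) :=
  (polyTime_isTransversal hE hS).and ((polyTime_removals hS).all
    (f := fun y : δ × List Bool => !isTransversal (E y.1) y.2)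
    (polyTime_isTransversal (hE.comp .fst) .snd).not)

theorem polyTime_inBits {T : δ → List (Option Bool)} (hT : PolyTime T) :
    PolyTime fun x => inBits (T x) :=
  hT.map (f := fun y : δ × Option Bool => decide (y.2 = some true))
    (PolyTime.finite_apply (enc_option_injective enc_bool_injective) .snd
      fun t => decide (t = some true))

theorem polyTime_setLast (c : Option Bool) {e : δ → List Bool} {T : δ → List (Option Bool)}
    (he : PolyTime e) (hT : PolyTime T) : PolyTime fun x => setLast c (e x) (T x) := by
  have hacc : PolyTime fun y : (δ × (Bool × List (Option Bool))) × (Bool × Option Bool) =>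
    y.1.2 := PolyTime.snd.comp .fst
  have hf : PolyTime fun y : (δ × (Bool × List (Option Bool))) × (Bool × Option Bool) =>
      setLastStep c y.2 y.1.2 :=
    PolyTime.ite (c := fun y : (δ × (Bool × List (Option Bool))) × (Bool × Option Bool) =>
        !y.1.2.1 && decide (y.2 = (true, none)))
      ((PolyTime.fst.comp hacc).not.and (PolyTime.finite_apply (enc_prod_injective
        enc_bool_injective (enc_option_injective enc_bool_injective)) .snd
        fun p => decide (p = (true, none))))
      ((PolyTime.const true).pair ((PolyTime.const c).cons (PolyTime.snd.comp hacc)))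
      ((PolyTime.fst.comp hacc).pair
        ((PolyTime.snd.comp .snd).cons (PolyTime.snd.comp hacc)))
  have hz := he.zip hT
  refine PolyTime.foldr (i := fun _ => (false, [])) hz (.const _) hf
    (((hz.2.mul (.const 6)).add (.const 5))) fun x l' h => ?_
  have h1 : l'.length ≤ esize ((e x).zip (T x)) := h.length_le.trans (length_le_esize _)
  have h2 := length_foldr_setLastStep c l'
  have h3 := esize_list_le (l := (l'.foldr (setLastStep c) (false, [])).2) (B := 5)
    fun t _ => esize_optionBool_le t
  have h4 := esize_bool (l'.foldr (setLastStep c) (false, [])).1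
  have h5 : esize (l'.foldr (setLastStep c) (false, [])) =
    esize (l'.foldr (setLastStep c) (false, [])).1 +
    esize (l'.foldr (setLastStep c) (false, [])).2 + 1 := rfl
  change esize (l'.foldr (setLastStep c) (false, [])) ≤ esize ((e x).zip (T x)) * 6 + 5
  omega

theorem polyTime_accepts {b k : ℕ} (τ : BlockTable b k) {gs : δ → List (Fin k)}
    {S : δ → List Bool} (hgs : PolyTime gs) (hS : PolyTime S) :
    PolyTime fun x => accepts τ (gs x) (S x) := by
  let f : (δ × (List Bool × Bool)) × Fin k → List Bool × Bool := fun y =>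
    (y.1.2.1.drop b, y.1.2.2 && decide (τ.canon (takePad b y.1.2.1) = y.2))
  have e (x : δ) (gs : List (Fin k)) (S : List Bool) (ok : Bool) :
      gs.foldl (fun a g => f ((x, a), g)) (S, ok) =
        (S.drop (b * gs.length), ok && accepts τ gs S) := by
    induction gs generalizing S ok with
    | nil => simp [accepts]
    | cons g gs ih =>
      simp only [List.foldl_cons, f, ih, accepts, List.drop_drop, List.length_cons]
      simp [Bool.and_assoc, mul_add, add_comm]
  have hR : PolyTime fun y : (δ × (List Bool × Bool)) × Fin k => y.1.2.1 :=
    PolyTime.fst.comp (PolyTime.snd.comp .fst)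
  have hf : PolyTime f := (hR.drop b).pair ((PolyTime.snd.comp (PolyTime.snd.comp .fst)).and
    (PolyTime.apply_takePad (f := fun y K => decide (τ.canon K = y.2))
      (fun K => PolyTime.finite_apply enc_fin_injective .snd fun g => decide (τ.canon K = g)) hR b))
  refine (PolyTime.snd.comp (PolyTime.foldl hgs (hS.pair (.const true)) hf
    (hS.2.add (.const 4)) fun x l' _ => ?_)).of_eq fun x => by rw [e]; simp
  rw [e]
  have h1 := esize_sublist (List.drop_sublist (b * l'.length) (S x))
  have h2 := esize_bool (true && accepts τ l' (S x))
  simp only [esize_prod]; omega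

end PolyTime

/-! ### The search -/

/-- The vertices, in unary, and the hyperedges. -/
abbrev Input : Type := List Unit × List (List Bool)

/-- A node of the search tree: the input, the vertices that do not yet belong to a guessed
block, the guesses, the partial vector, and the number of vertices that may still be put in. -/
abbrev Node (k : ℕ) : Type := Input × List Unit × List (Fin k) × List (Option Bool) × ℕ

/-- The root of the search tree. -/
def root (k : ℕ) (i : Input) : Node k := (i, i.1, [], [], 0)

/-- The first hyperedge that a partial vector does not hit. -/
def unhit (E : List (List Bool)) (T : List (Option Bool)) : Option (List Bool) :=
  E.find? fun e => !hit e (inBits T)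

/-- Guess the next block. -/
def guessStep {b k : ℕ} (τ : BlockTable b k) (x : Node k) : List (Node k) :=
  (List.finRange k).map fun g =>
    (x.1, x.2.1.drop b, g :: x.2.2.1, τ.X g ++ x.2.2.2.1, x.2.2.2.2 + τ.j g)

/-- Branch on a vertex of the hyperedge `e`. -/
def branchStep {k : ℕ} (x : Node k) (e : List Bool) : List (Node k) :=
  if (setLast (some true) e x.2.2.2.1).1 = true then
    [(x.1, [], x.2.2.1, (setLast (some true) e x.2.2.2.1).2, x.2.2.2.2 - 1),
      (x.1, [], x.2.2.1, (setLast (some false) e x.2.2.2.1).2, x.2.2.2.2)]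
  else []

/-- The set at a leaf of the search tree. -/
def leafSet {k : ℕ} (x : Node k) : List Bool := (x.1.1.zip (inBits x.2.2.2.1)).map fun p => p.2

/-- The output at a leaf of the search tree. -/
def leafStep {b k : ℕ} (τ : BlockTable b k) (x : Node k) : Option (List Bool) :=
  if (isMinimalTransversal x.1.2 (leafSet x) && accepts τ x.2.2.1 (leafSet x)) = true then
    some (leafSet x) else none

/-- The output and the children of a node of the search tree. -/
def step {b k : ℕ} (τ : BlockTable b k) (x : Node k) : Option (List Bool) × List (Node k) :=
  if x.2.1 ≠ [] then (none, guessStep τ x)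
  else (unhit x.1.2 x.2.2.2.1).elim (leafStep τ x, []) fun e =>
    if x.2.2.2.2 ≠ 0 then (none, branchStep x e) else (none, [])

theorem polyTime_root (k : ℕ) : PolyTime (root k) :=
  PolyTime.id.pair (PolyTime.fst.pair (.const ([], [], 0)))

theorem polyTime_step {b k : ℕ} (τ : BlockTable b k) : PolyTime (step τ) := by
  have hi : PolyTime fun x : Node k => x.1 := .fst
  have hV : PolyTime fun x : Node k => x.1.1 := .comp .fst .fst
  have hE : PolyTime fun x : Node k => x.1.2 := .comp .snd .fst
  have hr : PolyTime fun x : Node k => x.2.1 := .comp .fst .snd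
  have h22 : PolyTime fun x : Node k => x.2.2 := .comp .snd .snd
  have hg : PolyTime fun x : Node k => x.2.2.1 := .comp .fst h22
  have h222 : PolyTime fun x : Node k => x.2.2.2 := .comp .snd h22
  have hT : PolyTime fun x : Node k => x.2.2.2.1 := .comp .fst h222
  have hJ : PolyTime fun x : Node k => x.2.2.2.2 := .comp .snd h222
  have hguess : PolyTime (guessStep τ) :=
    (PolyTime.const (List.finRange k)).map (f := fun y : Node k × Fin k =>
      (y.1.1, y.1.2.1.drop b, y.2 :: y.1.2.2.1, τ.X y.2 ++ y.1.2.2.2.1, y.1.2.2.2.2 + τ.j y.2))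
      ((hi.comp .fst).pair (((hr.comp .fst).drop b).pair ((PolyTime.snd.cons (hg.comp .fst)).pair
        ((PolyTime.finite_dispatch enc_fin_injective
          (f := fun (g : Fin k) (y : Node k × Fin k) => τ.X g ++ y.1.2.2.2.1) .snd
          fun g => (hT.comp .fst).append_const (τ.X g)).pair
        (PolyTime.finite_dispatch enc_fin_injective
          (f := fun (g : Fin k) (y : Node k × Fin k) => y.1.2.2.2.2 + τ.j g) .snd
          fun g => (hJ.comp .fst).add_const (τ.j g))))))
  have hset (c : Option Bool) : PolyTime fun y : Node k × List Bool => setLast c y.2 y.1.2.2.2.1 :=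
    polyTime_setLast c .snd (hT.comp .fst)
  have hbranch : PolyTime fun y : Node k × List Bool => branchStep y.1 y.2 :=
    PolyTime.ite (PolyTime.fst.comp (hset _))
      (((hi.comp .fst).pair ((PolyTime.const []).pair ((hg.comp .fst).pair
        ((PolyTime.snd.comp (hset _)).pair (hJ.comp .fst).pred)))).cons
      (((hi.comp .fst).pair ((PolyTime.const []).pair ((hg.comp .fst).pair
        ((PolyTime.snd.comp (hset _)).pair (hJ.comp .fst))))).cons (.const [])))
      (.const [])
  have hS : PolyTime (leafSet (k := k)) :=
    (hV.zip (polyTime_inBits hT)).map (f := fun y : Node k × (Unit × Bool) => y.2.2)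
      (PolyTime.snd.comp .snd)
  have hleaf : PolyTime (leafStep τ) :=
    PolyTime.ite ((polyTime_isMinimalTransversal hE hS).and (polyTime_accepts τ hg hS))
      hS.some (.const none)
  have hunhit : PolyTime fun x : Node k => unhit x.1.2 x.2.2.2.1 :=
    hE.find? (f := fun y : Node k × List Bool => !hit y.2 (inBits y.1.2.2.2.1))
      (polyTime_hit .snd (polyTime_inBits (hT.comp .fst))).not
  exact hr.ite_nil ((PolyTime.const none).pair hguess)
    (PolyTime.option_elim (g := fun y : Node k × List Bool =>
      if y.1.2.2.2.2 ≠ 0 then (none, branchStep y.1 y.2) else (none, [])) hunhit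
      (hleaf.pair (.const [])) ((hJ.comp .fst).ite_zero ((PolyTime.const none).pair hbranch)
        (.const _)))

/-! ### Lemmas on vectors -/

theorem hit_cons (a : Bool) (e : List Bool) (s : Bool) (S : List Bool) :
    hit (a :: e) (s :: S) = ((a && s) || hit e S) := rfl

@[simp] theorem hit_nil_left (S : List Bool) : hit [] S = false := rfl
@[simp] theorem hit_nil_right (e : List Bool) : hit e [] = false := by simp [hit]

theorem hit_take {e : List Bool} {n : ℕ} (h : e.length ≤ n) (S : List Bool) :
    hit e (S.take n) = hit e S := by
  induction e generalizing n S with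
  | nil => rfl
  | cons a e ih =>
    obtain ⟨n, rfl⟩ : ∃ m, n = m + 1 := ⟨n - 1, by simp at h; omega⟩
    cases S with
    | nil => rfl
    | cons s S => rw [List.take_succ_cons, hit_cons, hit_cons, ih (by simpa using h)]

/-- Inclusion of sets with the given characteristic vectors. -/
abbrev VecLE (S S' : List Bool) : Prop := List.Forall₂ (fun a b => a = true → b = true) S S'

theorem hit_mono {e S S' : List Bool} (h : VecLE S S') (he : hit e S = true) :
    hit e S' = true := by
  induction h generalizing e with
  | nil => exact he
  | cons hab _ ih =>
    cases e with
    | nil => exact he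
    | cons a e =>
      rw [hit_cons, Bool.or_eq_true, Bool.and_eq_true] at he ⊢
      exact he.imp (fun h => ⟨h.1, hab h.2⟩) ih

theorem isTransversal_iff {E : List (List Bool)} {S : List Bool} :
    isTransversal E S = true ↔ ∀ e ∈ E, hit e S = true := by
  simp [isTransversal]

theorem VecLE.isTransversal {E : List (List Bool)} {S S' : List Bool} (h : VecLE S S')
    (hS : isTransversal E S = true) : isTransversal E S' = true :=
  isTransversal_iff.2 fun e he => hit_mono h (isTransversal_iff.1 hS e he)

theorem vecLE_refl (S : List Bool) : VecLE S S := by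
  induction S with
  | nil => exact .nil
  | cons s S ih => exact .cons (fun h => h) ih

/-- A proper subset misses some element and so lies in the removal of that element. As
transversality is monotone, testing the one-element removals decides minimality. -/
theorem VecLE.eq_or_le_removal {S S' : List Bool} (h : VecLE S S') :
    S = S' ∨ ∃ r ∈ removals S', VecLE S r := by
  induction h with
  | nil => exact Or.inl rfl
  | @cons a b S S' hab h ih =>
    rcases ih with rfl | ⟨r, hr, hSr⟩
    · by_cases h' : a = b
      · exact Or.inl (by rw [h'])
      · obtain ⟨rfl, rfl⟩ : a = false ∧ b = true := by cases a <;> cases b <;> simp_all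
        exact Or.inr ⟨false :: S, by simp [removals], .cons (fun h => h) (vecLE_refl S)⟩
    · refine Or.inr ⟨b :: r, ?_, .cons hab hSr⟩
      cases b <;> simp [removals, hr]

theorem removal_spec {S r : List Bool} (h : r ∈ removals S) : VecLE r S ∧ ¬ VecLE S r := by
  induction S generalizing r with
  | nil => simp [removals] at h
  | cons s S ih =>
    have key : ∀ r ∈ removals S, VecLE (s :: r) (s :: S) ∧ ¬ VecLE (s :: S) (s :: r) :=
      fun r hr => ⟨.cons (fun h => h) (ih hr).1, fun h => (ih hr).2 (List.forall₂_cons.1 h).2⟩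
    cases s
    · simp only [removals, Bool.false_eq_true, if_false, List.mem_map] at h
      obtain ⟨r, hr, rfl⟩ := h
      exact key r hr
    · simp only [removals, if_true, List.mem_cons, List.mem_map] at h
      rcases h with rfl | ⟨r, hr, rfl⟩
      · exact ⟨.cons (by simp) (vecLE_refl S), fun h => by simpa using (List.forall₂_cons.1 h).1⟩
      · exact key r hr

theorem isMinimalTransversal_iff {E : List (List Bool)} {S : List Bool} :
    isMinimalTransversal E S = true ↔ isTransversal E S = true ∧
      ∀ S', VecLE S' S → isTransversal E S' = true → S' = S := by
  rw [isMinimalTransversal, Bool.and_eq_true]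
  refine and_congr_right fun _ => ?_
  simp only [List.all_eq_true, Bool.not_eq_true']
  constructor
  · intro h S' hle hS'
    refine hle.eq_or_le_removal.resolve_right ?_
    rintro ⟨r, hr, hSr⟩
    have := h r hr
    rw [hSr.isTransversal hS'] at this
    exact Bool.noConfusion this
  · intro h r hr
    by_contra h'
    obtain ⟨h1, h2⟩ := removal_spec hr
    have := h r h1 (by simpa using h')
    exact h2 (this ▸ h1)

/-! ### Agreement and budget under truncation, concatenation and branching -/

/-- Truncation is needed because the last block may stick out beyond the vertices, so that a partial
vector can be longer than `S`. -/
theorem agrees_take {n : ℕ} {S : List Bool} (h : S.length ≤ n) (T : List (Option Bool)) :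
    Agrees (T.take n) S ↔ Agrees T S := by
  induction S generalizing n T with
  | nil => simp
  | cons s S ih =>
    obtain ⟨n, rfl⟩ : ∃ m, n = m + 1 := ⟨n - 1, by simp at h; omega⟩
    cases T with
    | nil => simp
    | cons t T => rw [List.take_succ_cons, agrees_cons, agrees_cons, ih (by simpa using h)]

theorem extra_take {n : ℕ} {S : List Bool} (h : S.length ≤ n) (T : List (Option Bool)) :
    extra (T.take n) S = extra T S := by
  induction S generalizing n T with
  | nil => simp
  | cons s S ih =>
    obtain ⟨n, rfl⟩ : ∃ m, n = m + 1 := ⟨n - 1, by simp at h; omega⟩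
    cases T with
    | nil => simp
    | cons t T => rw [List.take_succ_cons, extra_cons, extra_cons, ih (by simpa using h)]

theorem agrees_append (A T : List (Option Bool)) (S : List Bool) :
    Agrees (A ++ T) S ↔ Agrees A S ∧ Agrees T (S.drop A.length) := by
  induction A generalizing S with
  | nil => simp
  | cons a A ih => cases S <;> simp [ih, and_assoc]

theorem extra_append (A T : List (Option Bool)) (S : List Bool) :
    extra (A ++ T) S = extra A S + extra T (S.drop A.length) := by
  induction A generalizing S with
  | nil => simp
  | cons a A ih => cases S <;> simp [ih, add_assoc]

theorem agrees_of_takePad {b : ℕ} {T : List (Option Bool)} {S : List Bool}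
    (h : Agrees T (takePad b S)) (hT : T.length ≤ b) : Agrees T S := by
  induction b generalizing T S with
  | zero => obtain rfl : T = [] := by simpa using hT
            simp
  | succ b ih =>
    cases T with
    | nil => simp
    | cons t T =>
      cases S with
      | nil => simp
      | cons s S =>
        simp only [takePad, List.headD_cons, List.tail_cons, agrees_cons, List.length_cons] at *
        exact ⟨h.1, ih h.2 (by omega)⟩

theorem extra_le_takePad {b : ℕ} {T : List (Option Bool)} (S : List Bool) (hT : T.length ≤ b) :
    extra T S ≤ extra T (takePad b S) := by
  induction b generalizing T S with
  | zero => obtain rfl : T = [] := by simpa using hT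
            simp
  | succ b ih =>
    cases T with
    | nil => simp
    | cons t T =>
      cases S with
      | nil => simp
      | cons s S =>
        simp only [takePad, List.headD_cons, List.tail_cons, extra_cons, List.length_cons] at *
        exact Nat.add_le_add_left (ih S (by omega)) _

theorem agrees_extra_setLast (A B : List (Option Bool)) (c : Bool) {S : List Bool}
    (hS : A.length < S.length) :
    (Agrees (A ++ some c :: B) S ↔ Agrees (A ++ none :: B) S ∧ S[A.length] = c) ∧
    (S[A.length] = c → extra (A ++ none :: B) S =
      extra (A ++ some c :: B) S + if c = true then 1 else 0) := by
  rw [agrees_append, agrees_append, extra_append, extra_append, List.drop_eq_getElem_cons hS]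
  constructor
  · simp only [agrees_cons, Option.some.injEq, forall_eq', reduceCtorEq, false_imp_iff,
      implies_true, true_and]
    tauto
  · rintro rfl
    cases h : S[A.length] <;> simp; omega

/-- Take a common element of `e` and `S`. It is not put in by `T`, since `T` misses `e`, and not
left out, since `T` agrees with `S`. So it is undecided, and it counts towards `extra`. -/
theorem exists_undecided {e S : List Bool} {T : List (Option Bool)} (hT : Agrees T S)
    (hS : hit e S = true) (h : hit e (inBits T) = false) (hl : e.length ≤ T.length) :
    0 < extra T S ∧ (true, none) ∈ e.zip T := by
  induction e generalizing S T with
  | nil => simp at hS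
  | cons a e ih =>
    cases S with
    | nil => simp at hS
    | cons s S =>
      cases T with
      | nil => simp at hl
      | cons t T =>
        rw [agrees_cons] at hT
        rw [hit_cons, Bool.or_eq_true] at hS
        have h' : ((a && decide (t = some true)) || hit e (inBits T)) = false := h
        rw [Bool.or_eq_false_iff] at h'
        rw [extra_cons]
        rcases hS with hS | hS
        · obtain ⟨rfl, rfl⟩ : a = true ∧ s = true := by simpa using hS
          have ht : t ≠ some true := by simpa using h'.1
          have : t = none := by
            rcases t with _ | c
            · rfl
            · exact absurd (by rw [hT.1 c rfl]) ht
          subst this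
          simp
        · obtain ⟨h1, h2⟩ := ih hT.2 hS h'.2 (by simpa using hl)
          exact ⟨by omega, by simp [h2]⟩

theorem vecLE_of_agrees {n : ℕ} {S : List Bool} {T : List (Option Bool)} (hT : Agrees T S)
    (hS : S.length = n) (hn : n ≤ T.length) : VecLE ((inBits T).take n) S := by
  induction S generalizing n T with
  | nil => subst hS; simp
  | cons s S ih =>
    subst hS
    cases T with
    | nil => simp at hn
    | cons t T =>
      rw [agrees_cons] at hT
      refine List.Forall₂.cons (fun h => ?_) (ih hT.2 rfl (by simpa using hn))
      exact (hT.1 true (by simpa using h)).symm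

theorem agrees_inBits (T : List (Option Bool)) (n : ℕ) :
    Agrees T ((inBits T).take n) ∧ extra T ((inBits T).take n) = 0 := by
  induction T generalizing n with
  | nil => simp
  | cons t T ih =>
    cases n with
    | zero => simp
    | succ n =>
      have := ih n
      simp only [inBits, List.map_cons, List.take_succ_cons, agrees_cons, extra_cons] at *
      rcases t with _ | _ | _ <;> simp [this]

theorem setLast_spec_aux (l : List (Bool × Option Bool)) :
    (∃ P Q, l = P ++ (true, none) :: Q ∧ ∀ c, l.foldr (setLastStep c) (false, []) =
      (true, P.map Prod.snd ++ c :: Q.map Prod.snd)) ∨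
    ((true, none) ∉ l ∧ ∀ c, l.foldr (setLastStep c) (false, []) = (false, l.map Prod.snd)) := by
  induction l with
  | nil => exact Or.inr ⟨by simp, fun c => rfl⟩
  | cons p l ih =>
    rcases ih with ⟨P, Q, rfl, h⟩ | ⟨h1, h2⟩
    · exact Or.inl ⟨p :: P, Q, rfl, fun c => by rw [List.foldr_cons, h]; simp [setLastStep]⟩
    · by_cases hp : p = (true, none)
      · exact Or.inl ⟨[], l, by rw [hp]; rfl, fun c => by
          rw [List.foldr_cons, h2]; simp [setLastStep, hp]⟩
      · exact Or.inr ⟨by simpa [h1] using Ne.symm hp, fun c => by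
          rw [List.foldr_cons, h2]; simp [setLastStep, hp]⟩

theorem zip_take_length {α β : Type*} (e : List α) (T : List β) :
    e.zip (T.take e.length) = e.zip T := by
  induction e generalizing T with
  | nil => simp
  | cons a e ih => cases T <;> simp [ih]

/-- Splitting of the vectors at the last undecided vertex. -/
theorem setLast_spec {e : List Bool} {T : List (Option Bool)} (h : e.length ≤ T.length) :
    (∃ e₁ e₂ A B, e = e₁ ++ true :: e₂ ∧ T.take e.length = A ++ none :: B ∧
      e₁.length = A.length ∧ ∀ c, setLast c e T = (true, A ++ c :: B)) ∨
    ((true, none) ∉ e.zip T ∧ ∀ c, (setLast c e T).1 = false) := by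
  have h1 : (e.zip T).map Prod.fst = e := List.map_fst_zip h
  have h2 : (e.zip T).map Prod.snd = T.take e.length := by
    rw [← zip_take_length, List.map_snd_zip (by simp)]
  rcases setLast_spec_aux (e.zip T) with ⟨P, Q, hz, hs⟩ | ⟨hn, hs⟩
  · refine Or.inl ⟨P.map Prod.fst, Q.map Prod.fst, P.map Prod.snd, Q.map Prod.snd,
      ?_, ?_, by simp, hs⟩
    · rw [← h1, hz]; simp
    · rw [← h2, hz]; simp
  · exact Or.inr ⟨hn, fun c => by rw [setLast, hs]⟩

/-- The table speaks of blocks of length exactly `b`. Padding by `false` extends it to a short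
block: the added positions create no extra elements, and without them agreement only gets weaker. -/
theorem accepts_head {b k : ℕ} (τ : BlockTable b k) {g : Fin k} {R : List Bool}
    (h : τ.canon (takePad b R) = g) : Agrees (τ.X g) R ∧ extra (τ.X g) R ≤ τ.j g := by
  subst h
  have hl := length_takePad b R
  exact ⟨agrees_of_takePad (τ.agrees _ hl) (τ.length_X _).le,
    (extra_le_takePad R (τ.length_X _).le).trans (τ.extra_le _ hl)⟩

theorem accepts_cons {b k : ℕ} {τ : BlockTable b k} {g : Fin k} {gs : List (Fin k)}
    {R : List Bool} :
    accepts τ (g :: gs) R = true ↔ τ.canon (takePad b R) = g ∧ accepts τ gs (R.drop b) = true := by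
  simp [accepts]

/-- The number of undecided vertices of a hyperedge. -/
def undecided (e : List Bool) (T : List (Option Bool)) : ℕ := (e.zip T).count (true, none)

theorem undecided_le (e : List Bool) (T : List (Option Bool)) : undecided e T ≤ e.count true := by
  induction e generalizing T with
  | nil => simp [undecided]
  | cons a e ih =>
    cases T with
    | nil => simp [undecided]
    | cons t T =>
      have := ih T
      simp only [undecided, List.zip_cons_cons, List.count_cons] at *
      cases a <;> rcases t with _ | t <;> simp <;> omega

/-! ### Analysis of the search tree -/

section

variable {b k : ℕ} (τ : BlockTable b k) (i : Input)

/-- The number of blocks of the vertices without a guess. -/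
def blocks (b : ℕ) (rest : List Unit) : ℕ := (rest.length + b - 1) / b

/-- Blocks are guessed from the end of the vertex list, and the count is rounded up. So the first
guess concerns the possibly short last block, and `b * blocks b rest` is the offset at which the
guessed part begins. -/
theorem blocks_drop {b : ℕ} (hb : 0 < b) {rest : List Unit} (h : rest ≠ []) :
    blocks b rest = blocks b (rest.drop b) + 1 := by
  have hr := List.length_pos_iff.2 h
  rw [blocks, blocks, List.length_drop]
  rcases le_or_gt b rest.length with hl | hl
  · rw [show rest.length + b - 1 = rest.length - b + b - 1 + b by omega, Nat.add_div_right _ hb]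
  · rw [show rest.length - b + b - 1 = b - 1 by omega, Nat.div_eq_of_lt (show b - 1 < b by omega),
      show rest.length + b - 1 = rest.length - 1 + b by omega, Nat.add_div_right _ hb,
      Nat.div_eq_of_lt (show rest.length - 1 < b by omega)]

@[simp] theorem blocks_nil {b : ℕ} (hb : 0 < b) : blocks b [] = 0 := by
  simp [blocks]; omega

/-- The invariant of the search on the input `i`. -/
structure NodeInv (x : Node k) : Prop where
  input : x.1 = i
  le_add : i.1.length ≤ x.2.1.length + x.2.2.2.1.length
  add_le : x.2.1.length + x.2.2.1.length ≤ i.1.length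
  length_le : x.2.2.2.1.length ≤ b * x.2.2.1.length + i.1.length
  budget_le : x.2.2.2.2 ≤ (∑ g, τ.j g) * x.2.2.1.length
  fits : x.2.1 ≠ [] → ∀ R, accepts τ x.2.2.1 R = true →
    Agrees x.2.2.2.1 R ∧ extra x.2.2.2.1 R ≤ x.2.2.2.2

/-- The sets that are written below a node of the search tree. -/
def nodeSpec (x : Node k) : Set (List Bool) :=
  {S | S.length = i.1.length ∧ isMinimalTransversal i.2 S = true ∧
    accepts τ x.2.2.1 (S.drop (b * blocks b x.2.1)) = true ∧
    Agrees x.2.2.2.1 (S.drop (b * blocks b x.2.1)) ∧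
    extra x.2.2.2.1 (S.drop (b * blocks b x.2.1)) ≤ x.2.2.2.2}

/-- A bound for the number of nodes below a node of the search tree. -/
def potential (x : Node k) : ℕ :=
  if x.2.1 ≠ [] then 26 * 5 ^ x.2.2.2.2 * (τ.cost + 1) ^ blocks b x.2.1
  else (unhit i.2 x.2.2.2.1).elim 1 fun e => (1 + 6 * undecided e x.2.2.2.1) * 5 ^ x.2.2.2.2

variable {τ i}

theorem mem_guessStep {x y : Node k} : y ∈ guessStep τ x ↔ ∃ g, y =
    (x.1, x.2.1.drop b, g :: x.2.2.1, τ.X g ++ x.2.2.2.1, x.2.2.2.2 + τ.j g) := by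
  simp only [guessStep, List.mem_map, List.mem_finRange, true_and, eq_comm]

theorem NodeInv.guess (hb : 0 < b) {x : Node k} (h : NodeInv τ i x) (hr : x.2.1 ≠ []) (g : Fin k) :
    NodeInv τ i (x.1, x.2.1.drop b, g :: x.2.2.1, τ.X g ++ x.2.2.2.1, x.2.2.2.2 + τ.j g) := by
  have hr' := List.length_pos_iff.2 hr
  refine ⟨h.input, ?_, ?_, ?_, ?_, fun _ R hR => ?_⟩
  · have := h.le_add
    simp only [List.length_drop, List.length_append, τ.length_X]; omega
  · have := h.add_le
    simp only [List.length_drop, List.length_cons]; omega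
  · have := h.length_le
    simp only [List.length_append, τ.length_X, List.length_cons, mul_add, mul_one]; omega
  · have := h.budget_le
    have : τ.j g ≤ ∑ g, τ.j g := Finset.single_le_sum (fun _ _ => Nat.zero_le _) (Finset.mem_univ g)
    simp only [List.length_cons, mul_add, mul_one]; omega
  · obtain ⟨h1, h2⟩ := accepts_cons.1 hR
    obtain ⟨h3, h4⟩ := accepts_head τ h1
    obtain ⟨h5, h6⟩ := h.fits hr _ h2
    refine ⟨(agrees_append _ _ _).2 ⟨h3, by rwa [τ.length_X]⟩, ?_⟩
    rw [extra_append, τ.length_X]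
    dsimp only
    omega

/-- The children partition the sets of `x` by the canonical guess for the next block. A child bounds
only the sum of the extras of old and new blocks; `fits` recovers the bound for the old ones from
the acceptance of their guesses. -/
theorem mem_nodeSpec_guess (hb : 0 < b) {x : Node k} (h : NodeInv τ i x) (hr : x.2.1 ≠ [])
    (g : Fin k) (S : List Bool) :
    S ∈ nodeSpec τ i (x.1, x.2.1.drop b, g :: x.2.2.1, τ.X g ++ x.2.2.2.1, x.2.2.2.2 + τ.j g) ↔
      S ∈ nodeSpec τ i x ∧ τ.canon (takePad b (S.drop (b * blocks b (x.2.1.drop b)))) = g := by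
  have hd : S.drop (b * blocks b x.2.1) = (S.drop (b * blocks b (x.2.1.drop b))).drop b := by
    rw [List.drop_drop, blocks_drop hb hr, mul_add, mul_one]
  simp only [nodeSpec, Set.mem_ofPred_eq, hd]
  set R := S.drop (b * blocks b (x.2.1.drop b))
  rw [accepts_cons]
  constructor
  · rintro ⟨h1, h2, ⟨h3, h4⟩, -, -⟩
    exact ⟨⟨h1, h2, h4, h.fits hr _ h4⟩, h3⟩
  · rintro ⟨⟨h1, h2, h3, h4, h5⟩, h6⟩
    obtain ⟨h7, h8⟩ := accepts_head τ h6
    refine ⟨h1, h2, ⟨h6, h3⟩, (agrees_append _ _ _).2 ⟨h7, by rwa [τ.length_X]⟩, ?_⟩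
    rw [extra_append, τ.length_X]
    omega

theorem unhit_some {E : List (List Bool)} {T : List (Option Bool)} {e : List Bool}
    (h : unhit E T = some e) : e ∈ E ∧ hit e (inBits T) = false :=
  ⟨List.mem_of_find?_eq_some h, by simpa using List.find?_some h⟩

theorem potential_le (hb : 0 < b) (hE : ∀ e ∈ i.2, e.count true ≤ 4) (x : Node k) :
    potential τ i x ≤ 26 * 5 ^ x.2.2.2.2 * (τ.cost + 1) ^ blocks b x.2.1 := by
  rw [potential]
  split_ifs with h
  · exact le_rfl
  · rw [not_not.1 h, blocks_nil hb, pow_zero, mul_one]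
    have h5 : 1 ≤ 5 ^ x.2.2.2.2 := Nat.one_le_pow _ _ (by norm_num)
    cases he : unhit i.2 x.2.2.2.1 with
    | none => simp; omega
    | some e =>
      have := (undecided_le e x.2.2.2.1).trans (hE e (unhit_some he).1)
      exact Nat.mul_le_mul_right _ (by omega)

/-- Here the rank enters: `25 = 1 + 6 * 4`, as an unhit hyperedge has at most four undecided
vertices. -/
theorem potential_le_of_nil (hE : ∀ e ∈ i.2, e.count true ≤ 4) {x : Node k} (hx : x.2.1 = []) :
    potential τ i x ≤ 25 * 5 ^ x.2.2.2.2 := by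
  rw [potential, if_neg (not_not.2 hx)]
  have h5 : 1 ≤ 5 ^ x.2.2.2.2 := Nat.one_le_pow _ _ (by norm_num)
  cases he : unhit i.2 x.2.2.2.1 with
  | none => simp; omega
  | some e =>
    have := (undecided_le e x.2.2.2.1).trans (hE e (unhit_some he).1)
    exact Nat.mul_le_mul_right _ (by omega)

/-- The budget grows by `τ.j g`, so the child for `g` has at most `M * 5 ^ τ.j g` nodes, together `M
* τ.cost`. The `+ 1` in the base `τ.cost + 1` leaves another `M ≥ 1` for the node itself. -/
theorem potential_guess (hb : 0 < b) (hE : ∀ e ∈ i.2, e.count true ≤ 4) {x : Node k}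
    (hr : x.2.1 ≠ []) : 1 + ((guessStep τ x).map (potential τ i)).sum ≤ potential τ i x := by
  set M := 26 * 5 ^ x.2.2.2.2 * (τ.cost + 1) ^ blocks b (x.2.1.drop b) with hM
  have hM1 : 1 ≤ M := by rw [hM]; exact Nat.succ_le_of_lt (by positivity)
  have h1 : ((guessStep τ x).map (potential τ i)).sum ≤ M * τ.cost := by
    rw [guessStep, List.map_map, ← List.ofFn_eq_map, List.sum_ofFn, BlockTable.cost, Finset.mul_sum]
    refine Finset.sum_le_sum fun g _ => (potential_le hb hE _).trans (le_of_eq ?_)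
    dsimp only
    rw [hM, pow_add]; ring
  have h2 : potential τ i x = M * (τ.cost + 1) := by
    rw [potential, if_pos hr, blocks_drop hb hr, pow_succ, hM]; ring
  rw [h2, mul_add, mul_one]
  omega

theorem hit_eq_of_take {T T' : List (Option Bool)} {n : ℕ}
    (h : (inBits T').take n = (inBits T).take n) {e : List Bool} (he : e.length ≤ n) :
    hit e (inBits T') = hit e (inBits T) := by
  rw [← hit_take he, h, hit_take he]

/-- What branching on a vertex of an unhit hyperedge `e` does. -/
theorem branch_spec (hE : ∀ e ∈ i.2, e.length = i.1.length) {x : Node k} (h : NodeInv τ i x)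
    (hx : x.2.1 = []) {e : List Bool} (he : unhit i.2 x.2.2.2.1 = some e) :
    (branchStep x e = [] ∧ nodeSpec τ i x = ∅) ∨
    ∃ (T₁ T₂ : List (Option Bool)) (m : ℕ),
      branchStep x e = [(i, [], x.2.2.1, T₁, x.2.2.2.2 - 1), (i, [], x.2.2.1, T₂, x.2.2.2.2)] ∧
      T₁.length = i.1.length ∧ T₂.length = i.1.length ∧
      undecided e x.2.2.2.1 = undecided e T₂ + 1 ∧ unhit i.2 T₂ = some e ∧
      ∀ S : List Bool, S.length = i.1.length →
        (Agrees T₁ S ↔ Agrees x.2.2.2.1 S ∧ S[m]? = some true) ∧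
        (Agrees T₂ S ↔ Agrees x.2.2.2.1 S ∧ S[m]? = some false) ∧
        (S[m]? = some true → extra x.2.2.2.1 S = extra T₁ S + 1) ∧
        (S[m]? = some false → extra x.2.2.2.1 S = extra T₂ S) ∧ S[m]?.isSome := by
  obtain ⟨heE, hunhit⟩ := unhit_some he
  have hen := hE e heE
  have hle : e.length ≤ x.2.2.2.1.length := by
    have := h.le_add
    rw [hx] at this
    simpa [hen] using this
  rcases setLast_spec hle with ⟨e₁, e₂, A, B, rfl, hT, hA, hs⟩ | ⟨hn, hs⟩
  · right
    set T := x.2.2.2.1 with hTdef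
    have hlen : (e₁ ++ true :: e₂).length = (A ++ none :: B).length := by
      rw [← hT, List.length_take]; omega
    have hAB : A.length + B.length + 1 = i.1.length := by
      rw [← hen, hlen]; simp; omega
    -- Leaving a vertex out does not change the set that is put in, so `e` remains the first unhit
    -- hyperedge, now with one undecided vertex fewer.
    have hin : (inBits (A ++ some false :: B)).take i.1.length = (inBits T).take i.1.length := by
      have : (inBits T).take i.1.length = inBits (A ++ none :: B) := by
        rw [← hT, hen, inBits, inBits, List.map_take]
      rw [this, List.take_of_length_le (by simp [inBits]; omega)]
      simp [inBits]
    refine ⟨A ++ some true :: B, A ++ some false :: B, A.length, ?_, by simp; omega,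
      by simp; omega, ?_, ?_, fun S hS => ?_⟩
    · rw [branchStep, hs, hs, h.input]; simp
    · have hz : (e₁ ++ true :: e₂).zip T = e₁.zip A ++ (true, none) :: e₂.zip B := by
        rw [← zip_take_length, hT, List.zip_append hA, List.zip_cons_cons]
      rw [undecided, undecided, hz, List.zip_append hA, List.zip_cons_cons]
      simp; omega
    · rw [← he]
      refine List.find?_congr fun e' he' => ?_
      rw [hit_eq_of_take hin (hE e' he').le]
    · have hAS : A.length < S.length := by omega
      have hTS : Agrees T S ↔ Agrees (A ++ none :: B) S := by
        rw [← hT, agrees_take (by omega)]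
      have hTx : extra T S = extra (A ++ none :: B) S := by
        rw [← hT, extra_take (by omega)]
      rw [hTS, hTx, List.getElem?_eq_getElem hAS]
      obtain ⟨h1, h2⟩ := agrees_extra_setLast A B true hAS
      obtain ⟨h3, h4⟩ := agrees_extra_setLast A B false hAS
      simp only [Option.some.injEq, Option.isSome_some, and_true]
      exact ⟨h1, h3, by simpa using h2, by simpa using h4⟩
  · left
    refine ⟨by simp [branchStep, hs], Set.eq_empty_of_forall_notMem fun S hS => hn ?_⟩
    obtain ⟨h1, h2, -, h4, -⟩ := hS
    have h4 : Agrees x.2.2.2.1 S := by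
      rw [hx] at h4
      rcases Nat.eq_zero_or_pos b with rfl | hb
      · simpa using h4
      · simpa [blocks_nil hb] using h4
    have h5 := isTransversal_iff.1 (isMinimalTransversal_iff.1 h2).1 e heE
    exact (exists_undecided h4 h5 hunhit hle).2

theorem mem_nodeSpec_of_nil (hb : 0 < b) {x : Node k} (hx : x.2.1 = []) (S : List Bool) :
    S ∈ nodeSpec τ i x ↔ S.length = i.1.length ∧ isMinimalTransversal i.2 S = true ∧
      accepts τ x.2.2.1 S = true ∧ Agrees x.2.2.2.1 S ∧ extra x.2.2.2.1 S ≤ x.2.2.2.2 := by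
  simp [nodeSpec, hx, blocks_nil hb]

/-- The set put in is a transversal and is contained in every set that agrees with the partial
vector. So it is the only candidate for a minimal transversal, and only minimality and the guesses
remain to be tested. -/
theorem leaf_spec (hb : 0 < b) (hE : ∀ e ∈ i.2, e.length = i.1.length) {x : Node k}
    (h : NodeInv τ i x) (hx : x.2.1 = []) (he : unhit i.2 x.2.2.2.1 = none) (S : List Bool) :
    S ∈ nodeSpec τ i x ↔ leafStep τ x = some S := by
  rw [mem_nodeSpec_of_nil hb hx]
  have hl : i.1.length ≤ x.2.2.2.1.length := by
    have := h.le_add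
    rw [hx] at this
    simpa using this
  have hleaf : leafSet x = (inBits x.2.2.2.1).take i.1.length := by
    rw [leafSet, h.input, ← zip_take_length]
    exact List.map_snd_zip (by simp)
  have hlen : (leafSet x).length = i.1.length := by
    rw [hleaf, List.length_take, inBits, List.length_map]; omega
  have htr : isTransversal i.2 (leafSet x) = true := isTransversal_iff.2 fun e hee => by
    rw [hleaf, hit_take (hE e hee).le]
    simpa using List.find?_eq_none.1 he e hee
  rw [leafStep, h.input]
  constructor
  · rintro ⟨h1, h2, h3, h4, h5⟩
    have : leafSet x = S := (isMinimalTransversal_iff.1 h2).2 _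
      (hleaf ▸ vecLE_of_agrees h4 h1 hl) htr
    subst this
    simp [h2, h3]
  · intro hS
    split_ifs at hS with hc
    obtain rfl : leafSet x = S := by simpa using hS
    rw [Bool.and_eq_true] at hc
    obtain ⟨h1, h2⟩ := agrees_inBits x.2.2.2.1 i.1.length
    exact ⟨hlen, hc.1, hc.2, hleaf ▸ h1, by rw [hleaf, h2]; exact Nat.zero_le _⟩

theorem nodeSpec_eq_empty (hb : 0 < b) (hE : ∀ e ∈ i.2, e.length = i.1.length) {x : Node k}
    (h : NodeInv τ i x) (hx : x.2.1 = []) {e : List Bool} (he : unhit i.2 x.2.2.2.1 = some e)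
    (hJ : x.2.2.2.2 = 0) : nodeSpec τ i x = ∅ := by
  refine Set.eq_empty_of_forall_notMem fun S hS => ?_
  obtain ⟨h1, h2, -, h4, h5⟩ := (mem_nodeSpec_of_nil hb hx S).1 hS
  obtain ⟨heE, hunhit⟩ := unhit_some he
  have hl := h.le_add
  rw [hx, ← hE e heE] at hl
  have := exists_undecided h4 (isTransversal_iff.1 (isMinimalTransversal_iff.1 h2).1 e heE) hunhit
    (by simpa using hl)
  omega

theorem searchTree (hb : 0 < b) (hE : ∀ e ∈ i.2, e.length = i.1.length)
    (hE4 : ∀ e ∈ i.2, e.count true ≤ 4) :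
    SearchTree (step τ) (NodeInv τ i) (potential τ i) (nodeSpec τ i) := by
  have hcases (x : Node k) (h : NodeInv τ i x) :
      (x.2.1 ≠ [] ∧ step τ x = (none, guessStep τ x)) ∨
      (step τ x = (leafStep τ x, []) ∧ x.2.1 = [] ∧ unhit i.2 x.2.2.2.1 = none) ∨
      (step τ x = (none, []) ∧ nodeSpec τ i x = ∅ ∧ x.2.1 = []) ∨
      ∃ e, step τ x = (none, branchStep x e) ∧ x.2.1 = [] ∧ unhit i.2 x.2.2.2.1 = some e ∧
        x.2.2.2.2 ≠ 0 := by
    by_cases hx : x.2.1 = []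
    · right
      rw [step, if_neg (not_not.2 hx), h.input]
      cases he : unhit i.2 x.2.2.2.1 with
      | none => exact Or.inl ⟨rfl, hx, rfl⟩
      | some e =>
        right
        by_cases hJ : x.2.2.2.2 = 0
        · exact Or.inl ⟨by simp [hJ], nodeSpec_eq_empty hb hE h hx he hJ, hx⟩
        · exact Or.inr ⟨e, by simp [hJ], hx, rfl, hJ⟩
    · exact Or.inl ⟨hx, by rw [step, if_pos hx]⟩
  have hpos (x : Node k) (hx : x.2.1 = []) : 1 ≤ potential τ i x := by
    rw [potential, if_neg (not_not.2 hx)]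
    cases unhit i.2 x.2.2.2.1 with
    | none => simp
    | some e => exact Nat.mul_pos (by omega) (by positivity)
  refine ⟨fun x h y hy => ?_, fun x h => ?_, fun x h S => ?_, fun x h => ?_,
    fun x h S hS y hy => ?_⟩
  · rcases hcases x h with ⟨hr, hs⟩ | ⟨hs, -⟩ | ⟨hs, -⟩ | ⟨e, hs, hx, he, hJ⟩
    · rw [hs] at hy
      obtain ⟨g, rfl⟩ := mem_guessStep.1 hy
      exact h.guess hb hr g
    · rw [hs] at hy; simp at hy
    · rw [hs] at hy; simp at hy
    · rw [hs] at hy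
      -- Branching decisions are not implied by the guesses, so `fits` need not survive them; it is
      -- demanded only while blocks remain to be guessed.
      have key (T : List (Option Bool)) (J : ℕ) (hT : T.length = i.1.length) (hJ : J ≤ x.2.2.2.2) :
          NodeInv τ i (i, [], x.2.2.1, T, J) :=
        ⟨rfl, by simp [hT], by have := h.add_le; simp only [List.length_nil]; omega,
          by simp only; omega, hJ.trans h.budget_le, fun h => absurd rfl h⟩
      rcases branch_spec hE h hx he with ⟨h1, -⟩ | ⟨T₁, T₂, m, h1, h2, h3, -⟩
      · simp [h1] at hy
      · simp only [h1, List.mem_cons, List.not_mem_nil, or_false] at hy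
        rcases hy with rfl | rfl
        · exact key _ _ h2 (Nat.sub_le _ _)
        · exact key _ _ h3 le_rfl
  · rcases hcases x h with ⟨hr, hs⟩ | ⟨hs, hx, -⟩ | ⟨hs, -, hx⟩ | ⟨e, hs, hx, he, hJ⟩
    · rw [hs]; exact potential_guess hb hE4 hr
    · rw [hs]; simpa using hpos x hx
    · rw [hs]; simpa using hpos x hx
    · rw [hs]
      rcases branch_spec hE h hx he with ⟨h1, -⟩ | ⟨T₁, T₂, m, h1, -, -, h4, h5, -⟩
      · simp only [h1]; simpa using hpos x hx
      · have e1 := potential_le_of_nil (τ := τ) hE4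
          (x := (i, [], x.2.2.1, T₁, x.2.2.2.2 - 1)) rfl
        have e2 : potential τ i (i, [], x.2.2.1, T₂, x.2.2.2.2) =
            (1 + 6 * undecided e T₂) * 5 ^ x.2.2.2.2 := by
          simp [potential, h5]
        have e3 : potential τ i x = (1 + 6 * (undecided e T₂ + 1)) * 5 ^ x.2.2.2.2 := by
          rw [potential, if_neg (not_not.2 hx), he, ← h4]; rfl
        have e4 : 5 ^ x.2.2.2.2 = 5 * 5 ^ (x.2.2.2.2 - 1) := by
          rw [← pow_succ']; congr 1; omega
        have e5 : 1 ≤ 5 ^ (x.2.2.2.2 - 1) := Nat.one_le_pow _ _ (by norm_num)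
        simp only [h1, List.map_cons, List.map_nil, List.sum_cons, List.sum_nil, e2, e3]
        have e6 : (1 + 6 * (undecided e T₂ + 1)) * 5 ^ x.2.2.2.2 =
          (1 + 6 * undecided e T₂) * 5 ^ x.2.2.2.2 + 6 * 5 ^ x.2.2.2.2 := by ring
        dsimp only at e1
        omega
  · rcases hcases x h with ⟨hr, hs⟩ | ⟨hs, hx, hn⟩ | ⟨hs, he, -⟩ | ⟨e, hs, hx, he, hJ⟩
    · rw [hs]
      simp only [mem_guessStep, reduceCtorEq, false_or]
      constructor
      · intro hS
        exact ⟨_, ⟨_, rfl⟩, (mem_nodeSpec_guess hb h hr _ S).2 ⟨hS, rfl⟩⟩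
      · rintro ⟨_, ⟨g, rfl⟩, hS⟩
        exact ((mem_nodeSpec_guess hb h hr _ S).1 hS).1
    · rw [hs, leaf_spec hb hE h hx hn]; simp
    · rw [hs, he]; simp
    · rw [hs]
      rcases branch_spec hE h hx he with ⟨h1, h2⟩ | ⟨T₁, T₂, m, h1, -, -, -, -, h6⟩
      · simp [h1, h2]
      · simp only [h1, List.mem_cons, List.not_mem_nil, or_false, exists_eq_or_imp,
          exists_eq_left, reduceCtorEq, false_or]
        rw [mem_nodeSpec_of_nil hb hx, mem_nodeSpec_of_nil hb rfl, mem_nodeSpec_of_nil hb rfl]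
        by_cases hS : S.length = i.1.length
        · obtain ⟨a1, a2, a3, a4, a5⟩ := h6 S hS
          obtain ⟨c, hc⟩ := Option.isSome_iff_exists.1 a5
          simp only [a1, a2, hc, Option.some.injEq] at *
          cases c
          · simp only [reduceCtorEq, and_false, false_and, and_true, false_or]
            rw [a4 rfl]
          · simp only [reduceCtorEq, and_false, false_and, and_true, or_false]
            rw [a3 rfl]
            have : extra T₁ S + 1 ≤ x.2.2.2.2 ↔ extra T₁ S ≤ x.2.2.2.2 - 1 := by omega
            rw [this]
        · simp [hS]
  · rcases hcases x h with ⟨hr, hs⟩ | ⟨hs, -⟩ | ⟨hs, -⟩ | ⟨e, hs, hx, he, hJ⟩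
    · rw [hs]
      refine List.pairwise_map.2 ((List.nodup_finRange k).imp fun {g g'} hg =>
        Set.disjoint_left.2 fun S h1 h2 => hg ?_)
      rw [← ((mem_nodeSpec_guess hb h hr _ S).1 h1).2, ← ((mem_nodeSpec_guess hb h hr _ S).1 h2).2]
    · simp [hs]
    · simp [hs]
    · rw [hs]
      rcases branch_spec hE h hx he with ⟨h1, -⟩ | ⟨T₁, T₂, m, h1, -, -, -, -, h6⟩
      · simp [h1]
      · simp only [h1, List.pairwise_cons, List.mem_cons, List.not_mem_nil, or_false, forall_eq,
          false_imp_iff, implies_true, List.Pairwise.nil, and_true]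
        refine Set.disjoint_left.2 fun S hS1 hS2 => ?_
        rw [mem_nodeSpec_of_nil hb rfl] at hS1 hS2
        obtain ⟨a1, a2, -⟩ := h6 S hS1.1
        have b1 := (a1.1 hS1.2.2.2.1).2
        have b2 := (a2.1 hS2.2.2.2.1).2
        simp [b1] at b2
  · rcases hcases x h with ⟨hr, hs⟩ | ⟨hs, -⟩ | ⟨hs, -⟩ | ⟨e, hs, -⟩ <;> simp [hs] at hS hy

theorem nodeInv_root : NodeInv τ i (root k i) := by
  refine ⟨rfl, ?_, ?_, ?_, ?_, fun _ R _ => ?_⟩ <;> simp [root]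

theorem nodeSpec_root : nodeSpec τ i (root k i) =
    {S | S.length = i.1.length ∧ isMinimalTransversal i.2 S = true} := by
  simp [nodeSpec, root, accepts]

/-- By `add_le` there are at most as many guesses as vertices. Partial vector and budget are linear
in these two numbers, with constants that depend on the table only. -/
theorem NodeInv.esize_le {x : Node k} (h : NodeInv τ i x) :
    esize x ≤ esize i + (2 * k + 6 * b + 2 * (∑ g, τ.j g) + 20) * (i.1.length + 1) := by
  obtain ⟨i', rest, gs, T, J⟩ := x
  obtain ⟨h1, -, h2, h3, h4, -⟩ := h
  dsimp only at h1 h2 h3 h4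
  subst h1
  set n := i'.1.length
  have a1 : esize rest ≤ rest.length * (1 + 1) + 1 := esize_list_le fun u _ => le_rfl
  have a2 : esize gs ≤ gs.length * (2 * k + 1 + 1) + 1 := esize_list_le fun g _ => by
    rw [esize, enc_fin]
    have := esize_nat (g : ℕ)
    rw [esize] at this
    omega
  have a3 : esize T ≤ T.length * (5 + 1) + 1 := esize_list_le fun t _ => esize_optionBool_le t
  have a4 := esize_nat J
  have b1 : gs.length ≤ n := by omega
  have b2 : rest.length ≤ n := by omega
  have b3 : gs.length * (2 * k + 1 + 1) ≤ n * (2 * k + 1 + 1) := Nat.mul_le_mul_right _ b1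
  have b4 : b * gs.length ≤ b * n := Nat.mul_le_mul_left _ b1
  have b5 : (∑ g, τ.j g) * gs.length ≤ (∑ g, τ.j g) * n := Nat.mul_le_mul_left _ b1
  simp only [esize_prod]
  set s := ∑ g, τ.j g
  have e1 : (2 * k + 6 * b + 2 * s + 20) * (n + 1) =
    2 * (n * k) + 6 * (b * n) + 2 * (s * n) + 20 * n + 2 * k + 6 * b + 2 * s + 20 := by ring
  have e2 : n * (2 * k + 1 + 1) = 2 * (n * k) + 2 * n := by ring
  omega

end

/-! ### Hypergraphs and their encodings -/

section

variable {α : Type*}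

open Classical in
/-- The characteristic vector of a set. -/
noncomputable def vec (vs : List α) (S : Set α) : List Bool := vs.map fun v => decide (v ∈ S)

@[simp] theorem length_vec (vs : List α) (S : Set α) : (vec vs S).length = vs.length := by
  simp [vec]

theorem encodeSet_eq (vs : List α) (S : Set α) : encodeSet vs S = Enc.enc (vec vs S) := by
  classical
  have h (P : Prop) [Decidable P] : Data.ofProp P = Enc.enc (decide P) := by
    by_cases hP : P <;> simp [Data.ofProp, hP]
  simp only [encodeSet, vec, Enc.enc, List.map_map]
  congr 1
  exact List.map_congr_left fun v _ => h _

/-- The input of the search. -/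
noncomputable def toInput (vs : List α) (es : List (Set α)) : Input :=
  (vs.map fun _ => (), es.map (vec vs))

theorem encodeHypergraph_eq (vs : List α) (es : List (Set α)) :
    encodeHypergraph vs es = Enc.enc (toInput vs es) := by
  have h1 : Data.ofList (vs.map fun _ => Data.nil) = Enc.enc (vs.map fun _ => ()) := by
    simp [Enc.enc]
  have h2 : Data.ofList (es.map (encodeSet vs)) = Enc.enc (es.map (vec vs)) := by
    rw [show Enc.enc (es.map (vec vs)) = Data.ofList ((es.map (vec vs)).map Enc.enc) from rfl,
      List.map_map]
    congr 1
    exact List.map_congr_left fun e _ => encodeSet_eq vs e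
  rw [encodeHypergraph, h1, h2]; rfl

theorem hit_vec (vs : List α) (e S : Set α) :
    hit (vec vs e) (vec vs S) = true ↔ ∃ v ∈ vs, v ∈ e ∧ v ∈ S := by
  simp [hit, vec, List.zip_map']

theorem vecLE_vec (vs : List α) (S S' : Set α) :
    VecLE (vec vs S) (vec vs S') ↔ ∀ v ∈ vs, v ∈ S → v ∈ S' := by
  simp [VecLE, vec, List.forall₂_map_left_iff, List.forall₂_map_right_iff, List.forall₂_same]

theorem exists_vec_eq {vs : List α} (h : vs.Nodup) {l : List Bool} (hl : l.length = vs.length) :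
    ∃ S : Set α, S ⊆ {v | v ∈ vs} ∧ vec vs S = l := by
  induction vs generalizing l with
  | nil => exact ⟨∅, by simp, (List.length_eq_zero_iff.1 hl).symm⟩
  | cons v vs ih =>
    cases l with
    | nil => simp at hl
    | cons c l =>
      rw [List.nodup_cons] at h
      obtain ⟨S, hS, rfl⟩ := ih h.2 (by simpa using hl)
      have hv : v ∉ S := fun h' => h.1 (hS h')
      cases c
      · exact ⟨S, fun w hw => List.mem_cons_of_mem _ (hS hw), by simp [vec, hv]⟩
      · refine ⟨insert v S, ?_, ?_⟩
        · rintro w (rfl | hw)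
          · simp
          · exact List.mem_cons_of_mem _ (hS hw)
        · simp only [vec, List.map_cons, Set.mem_insert_iff, true_or, decide_true, List.cons.injEq,
            true_and]
          refine List.map_congr_left fun w hw => ?_
          have : w ≠ v := fun h' => h.1 (h' ▸ hw)
          simp [this]

theorem isTransversal_vec {H : Hypergraph α} {vs : List α} {es : List (Set α)}
    (hvs : Lists vs H.vertexSet) (hes : Lists es H.edgeSet) {S : Set α} (hS : S ⊆ H.vertexSet) :
    isTransversal (toInput vs es).2 (vec vs S) = true ↔ H.IsTransversal S := by
  rw [isTransversal_iff, Hypergraph.IsTransversal, and_iff_right hS]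
  simp only [toInput, List.mem_map, forall_exists_index, and_imp, forall_apply_eq_imp_iff₂, hit_vec,
    hvs.2, hes.2]
  exact forall₂_congr fun e _ => ⟨fun ⟨v, _, h1, h2⟩ => ⟨v, h2, h1⟩,
    fun ⟨v, h1, h2⟩ => ⟨v, hS h1, h2, h1⟩⟩

/-- Minimality of the vector ranges over all bit lists below it. These have the same length, so each
of them is the vector of a set of vertices. -/
theorem isMinimalTransversal_vec {H : Hypergraph α} {vs : List α} {es : List (Set α)}
    (hvs : Lists vs H.vertexSet) (hes : Lists es H.edgeSet) {S : Set α} (hS : S ⊆ H.vertexSet) :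
    isMinimalTransversal (toInput vs es).2 (vec vs S) = true ↔ H.IsMinimalTransversal S := by
  rw [isMinimalTransversal_iff, isTransversal_vec hvs hes hS, Hypergraph.IsMinimalTransversal,
    Minimal]
  refine and_congr_right fun _ => ⟨fun h S' hS' hle => ?_, fun h l hle hl => ?_⟩
  · have := h (vec vs S') ((vecLE_vec vs S' S).2 fun v _ hv => hle hv)
      ((isTransversal_vec hvs hes hS'.1).2 hS')
    exact fun v hv => (vecLE_vec vs S S').1 (this ▸ vecLE_refl _) v ((hvs.2 v).2 (hS hv)) hv
  · obtain ⟨S', hS', rfl⟩ := exists_vec_eq hvs.1 (by simpa using hle.length_eq)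
    have hS' : S' ⊆ H.vertexSet := fun v hv => (hvs.2 v).1 (hS' hv)
    have h1 : S' ⊆ S := fun v hv => (vecLE_vec vs S' S).1 hle v ((hvs.2 v).2 (hS' hv)) hv
    rw [h1.antisymm (h ((isTransversal_vec hvs hes hS').1 hl) h1)]

theorem Lists.length_eq_ncard {l : List α} {A : Set α} (h : Lists l A) : l.length = A.ncard := by
  classical
  have : A = (l.toFinset : Set α) := by ext; simp [h.2]
  rw [this, Set.ncard_coe_finset, List.toFinset_card_of_nodup h.1]

theorem count_vec_le {vs : List α} (h : vs.Nodup) {e : Set α} (he : e.encard ≤ 4) :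
    (vec vs e).count true ≤ 4 := by
  classical
  have h1 : (vec vs e).count true = (vs.filter fun v => decide (v ∈ e)).length := by
    rw [vec, List.count, List.countP_map, List.countP_eq_length_filter]
    congr 1
    exact List.filter_congr fun v _ => by simp
  rw [h1, ← List.toFinset_card_of_nodup (h.filter _)]
  have h2 : (((vs.filter fun v => decide (v ∈ e)).toFinset : Finset α) : Set α) ⊆ e :=
    fun v hv => by
    simpa using (List.mem_filter.1 (List.mem_toFinset.1 hv)).2
  have h3 := (Set.encard_le_encard h2).trans he
  rw [Set.encard_coe_eq_coe_finsetCard] at h3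
  exact_mod_cast h3

/-- There are polynomially many sets of at most four vertices. -/
theorem length_edges_le {vs : List α} (h : vs.Nodup) {es : List (Set α)} (hes : es.Nodup)
    (hsub : ∀ e ∈ es, ∀ v ∈ e, v ∈ vs) (h4 : ∀ e ∈ es, e.encard ≤ 4) :
    es.length ≤ 5 * (vs.length + 1) ^ 4 := by
  classical
  let f : Set α → Finset α := fun e => vs.toFinset.filter (· ∈ e)
  have hf : ∀ e ∈ es, (f e : Set α) = e := fun e he => by
    ext v
    simpa [f] using hsub e he v
  rw [← List.toFinset_card_of_nodup hes]
  have h1 : es.toFinset.card ≤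
      ((Finset.range 5).biUnion fun i => vs.toFinset.powersetCard i).card := by
    refine Finset.card_le_card_of_injOn f (fun e he => ?_) fun e he e' he' hee => ?_
    · have he : e ∈ es := by simpa using he
      have hc := h4 e he
      rw [← hf e he, Set.encard_coe_eq_coe_finsetCard] at hc
      have hc : (f e).card ≤ 4 := by exact_mod_cast hc
      simp only [Finset.coe_biUnion, Set.mem_iUnion, Finset.mem_coe, Finset.mem_powersetCard]
      exact ⟨(f e).card, Finset.mem_range.2 (by omega), Finset.filter_subset _ _, rfl⟩
    · rw [← hf e (by simpa using he), ← hf e' (by simpa using he'), hee]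
  refine h1.trans (Finset.card_biUnion_le.trans ?_)
  calc _ ≤ ∑ i ∈ Finset.range 5, (vs.length + 1) ^ 4 := Finset.sum_le_sum fun i hi => by
        rw [Finset.card_powersetCard, List.toFinset_card_of_nodup h]
        calc _ ≤ vs.length ^ i := Nat.choose_le_pow _ _
          _ ≤ (vs.length + 1) ^ i := Nat.pow_le_pow_left (by omega) _
          _ ≤ _ := Nat.pow_le_pow_right (by omega) (by have := Finset.mem_range.1 hi; omega)
    _ = _ := by simp

/-- The time bound may depend only on the number of vertices, so the input must be polynomial in it
whatever the hyperedges are. -/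
theorem esize_toInput_le {vs : List α} (h : vs.Nodup) {es : List (Set α)} (hes : es.Nodup)
    (hsub : ∀ e ∈ es, ∀ v ∈ e, v ∈ vs) (h4 : ∀ e ∈ es, e.encard ≤ 4) :
    esize (toInput vs es) ≤ 25 * (vs.length + 1) ^ 5 := by
  set n := vs.length with hn
  have h1 : esize (vs.map fun _ => ()) ≤ n * 2 + 1 :=
    (esize_list_le (B := 1) fun _ _ => le_rfl).trans (by simp [hn])
  have h2 : esize (es.map (vec vs)) ≤ (5 * (n + 1) ^ 4) * (n * 4 + 1 + 1) + 1 := by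
    refine (esize_list_le (B := n * 4 + 1) fun l hl => ?_).trans ?_
    · obtain ⟨e, -, rfl⟩ := List.mem_map.1 hl
      simpa using esize_bits_le (vec vs e)
    · rw [List.length_map]
      gcongr
      exact length_edges_le h hes hsub h4
  have h3 : (n + 1) ≤ (n + 1) ^ 5 := Nat.le_self_pow (by norm_num) _
  have h4 : (5 * (n + 1) ^ 4) * (n * 4 + 1 + 1) ≤ (5 * (n + 1) ^ 4) * (4 * (n + 1)) :=
    Nat.mul_le_mul_left _ (by omega)
  have h5 : (5 * (n + 1) ^ 4) * (4 * (n + 1)) = 20 * (n + 1) ^ 5 := by ring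
  rw [toInput, esize_prod]
  omega

end

/-! ### Running time and correctness of the algorithm -/

theorem encard_le_of_rank_le {α : Type*} {H : Hypergraph α} (h : H.rank ≤ 4) {e : Set α}
    (he : e ∈ H.edgeSet) : e.encard ≤ 4 :=
  (le_iSup₂ (f := fun (e : Set α) (_ : e ∈ H.edgeSet) => e.encard) e he).trans h

/-- A polynomial times a power of `1.88`, with exponents rounded up to multiples of `b`, is
`O(1.8863 ^ n)`. -/
theorem isBigO_time {b D A c : ℕ} (hb : 0 < b) (hD : (D : ℝ) ≤ 1.88 ^ b) :
    (fun n : ℕ => (((A * (n + 1) ^ 5) ^ c * (26 * D ^ ((n + b - 1) / b) + 1) : ℕ) : ℝ)) =O[atTop]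
      fun n : ℕ => (1.8863 : ℝ) ^ n := by
  have h := (isLittleO_pow_const_mul_const_pow_const_pow_of_norm_lt (R := ℝ) (5 * c)
    (r₁ := 1.88) (r₂ := 1.8863) (by norm_num)).isBigO
  refine IsBigO.trans ?_ h
  refine IsBigO.of_bound ((A * 2 ^ 5 : ℝ) ^ c * (27 * 1.88 ^ b)) ?_
  filter_upwards [eventually_ge_atTop 1] with n hn
  rw [Real.norm_of_nonneg (by positivity), Real.norm_of_nonneg (by positivity)]
  have h1 : (D : ℝ) ^ ((n + b - 1) / b) ≤ 1.88 ^ b * 1.88 ^ n := by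
    calc (D : ℝ) ^ ((n + b - 1) / b) ≤ (1.88 ^ b) ^ ((n + b - 1) / b) := by gcongr
      _ = 1.88 ^ (b * ((n + b - 1) / b)) := by rw [pow_mul]
      _ ≤ 1.88 ^ (b + n) := pow_le_pow_right₀ (by norm_num)
        ((Nat.mul_div_le _ _).trans (by omega))
      _ = _ := pow_add _ _ _
  have h2 : (1 : ℝ) ≤ 1.88 ^ b * 1.88 ^ n := by
    rw [← pow_add]; exact one_le_pow₀ (by norm_num)
  have h3 : ((n : ℝ) + 1) ≤ 2 * n := by
    have : (1 : ℝ) ≤ n := by exact_mod_cast hn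
    linarith
  push_cast
  calc (A * ((n : ℝ) + 1) ^ 5) ^ c * (26 * (D : ℝ) ^ ((n + b - 1) / b) + 1)
      ≤ (A * (2 * (n : ℝ)) ^ 5) ^ c * (27 * (1.88 ^ b * 1.88 ^ n)) := by
        gcongr
        linarith
    _ = _ := by rw [mul_pow, mul_pow, mul_pow, mul_pow, pow_mul]; ring

/-- The enumeration algorithm. -/
theorem exists_enumeration :
    ∃ (p : TreeMachine.Prog) (T : ℕ → ℕ),
      (fun n : ℕ => (T n : ℝ)) =O[atTop] (fun n : ℕ => (1.8863 : ℝ) ^ n) ∧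
      ∀ (α : Type*) (H : Hypergraph α), H.vertexSet.Finite → H.rank ≤ 4 →
        EnumeratesWithin p H (T H.vertexSet.ncard) := by
  obtain ⟨b, k, τ, hb, hcost⟩ := exists_blockTable
  obtain ⟨p, c, hp⟩ := exists_search (polyTime_root k) (polyTime_step τ)
  set C := 2 * k + 6 * b + 2 * (∑ g, τ.j g) + 20 with hC
  refine ⟨p, fun n => ((C + 26) * (n + 1) ^ 5) ^ c * (26 * (τ.cost + 1) ^ ((n + b - 1) / b) + 1),
    isBigO_time hb (by push_cast; exact hcost), fun α H _ hrank vs es hvs hes => ?_⟩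
  set i := toInput vs es with hi
  have hlen : i.1.length = vs.length := by simp [hi, toInput]
  have hE (l : List Bool) (hl : l ∈ i.2) : ∃ e ∈ H.edgeSet, vec vs e = l := by
    obtain ⟨e, he, rfl⟩ := List.mem_map.1 hl
    exact ⟨e, (hes.2 e).1 he, rfl⟩
  have hE1 : ∀ l ∈ i.2, l.length = i.1.length := fun l hl => by
    obtain ⟨e, -, rfl⟩ := hE l hl
    simp [hlen]
  have hE4 : ∀ l ∈ i.2, l.count true ≤ 4 := fun l hl => by
    obtain ⟨e, he, rfl⟩ := hE l hl
    exact count_vec_le hvs.1 (encard_le_of_rank_le hrank he)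
  have hsize : esize i ≤ 25 * (vs.length + 1) ^ 5 := esize_toInput_le hvs.1 hes.1
    (fun e he v hv => (hvs.2 v).2 (H.subset_vertexSet_of_mem_edgeSet' ((hes.2 e).1 he) hv))
    fun e he => encard_le_of_rank_le hrank ((hes.2 e).1 he)
  have hpow : vs.length + 1 ≤ (vs.length + 1) ^ 5 := Nat.le_self_pow (by norm_num) _
  have hB (x : Node k) (hx : NodeInv τ i x) : esize x ≤ (C + 25) * (vs.length + 1) ^ 5 := by
    refine hx.esize_le.trans ?_
    rw [← hC, hlen]
    have h1 := Nat.mul_le_mul_left C hpow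
    have h2 : (C + 25) * (vs.length + 1) ^ 5 =
      C * (vs.length + 1) ^ 5 + 25 * (vs.length + 1) ^ 5 := add_mul _ _ _
    omega
  obtain ⟨out, t, hnd, hmem, ht, hrun⟩ := hp i _ _ _ ((C + 25) * (vs.length + 1) ^ 5)
    (searchTree hb hE1 hE4) nodeInv_root hB (hsize.trans (Nat.mul_le_mul_right _ (by omega)))
  have hout : ∀ l ∈ out, ∃ S, S ⊆ H.vertexSet ∧ vec vs S = l := fun l hl => by
    have := (hmem l).1 hl
    rw [nodeSpec_root] at this
    obtain ⟨S, hS, rfl⟩ := exists_vec_eq hvs.1 (this.1.trans hlen)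
    exact ⟨S, fun v hv => (hvs.2 v).1 (hS hv), rfl⟩
  have hmem' {S : Set α} (hS : S ⊆ H.vertexSet) : vec vs S ∈ out ↔ H.IsMinimalTransversal S := by
    rw [hmem, nodeSpec_root, Set.mem_ofPred_eq, hi, isMinimalTransversal_vec hvs hes hS, ← hi, hlen]
    simp
  -- The search lists vectors, and `f` decodes them. It is injective on `out` because `vec vs`
  -- undoes it. Every minimal transversal is reached because `vec vs` is injective on sets of
  -- vertices.
  choose! f hf hfv using hout
  refine ⟨out.map f, t, ⟨?_, fun S => ?_⟩, ht.trans ?_, ?_⟩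
  · refine hnd.map_on fun l hl l' hl' h => ?_
    rw [← hfv l hl, ← hfv l' hl', h]
  · rw [List.mem_map, Set.mem_ofPred_eq]
    constructor
    · rintro ⟨l, hl, rfl⟩
      rw [← hmem' (hf l hl), hfv l hl]
      exact hl
    · intro hS
      have h1 := (hmem' hS.1.1).2 hS
      refine ⟨_, h1, ?_⟩
      have h2 : vec vs (f (vec vs S)) = vec vs S := hfv _ h1
      ext v
      have h3 := (vecLE_vec vs (f (vec vs S)) S).1 (by rw [h2]; exact vecLE_refl _) v
      have h4 := (vecLE_vec vs S (f (vec vs S))).1 (by rw [h2]; exact vecLE_refl _) v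
      exact ⟨fun h => h3 ((hvs.2 v).2 (hf _ h1 h)) h, fun h => h4 ((hvs.2 v).2 (hS.1.1 h)) h⟩
  · rw [← hvs.length_eq_ncard]
    have h1 := potential_le hb hE4 (τ := τ) (root k i)
    have h2 : blocks b (root k i).2.1 = (vs.length + b - 1) / b := by rw [blocks, root, hlen]
    rw [h2] at h1
    have h3 : 26 * 5 ^ (root k i).2.2.2.2 * (τ.cost + 1) ^ ((vs.length + b - 1) / b) =
        26 * (τ.cost + 1) ^ ((vs.length + b - 1) / b) := by simp [root]
    rw [h3] at h1
    refine Nat.mul_le_mul (Nat.pow_le_pow_left ?_ c) (Nat.succ_le_succ h1)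
    have : (C + 26) * (vs.length + 1) ^ 5 = (C + 25) * (vs.length + 1) ^ 5 +
      (vs.length + 1) ^ 5 := by ring
    omega
  · rw [encodeHypergraph_eq, List.map_map]
    convert hrun using 1
    exact List.map_congr_left fun l hl => by
      rw [Function.comp_apply, encodeSet_eq, hfv l hl]

end TransversalEnumeration

theorem theorem3 :
    (∃ (p : TreeMachine.Prog) (T : ℕ → ℕ),
      (fun n : ℕ => (T n : ℝ)) =O[atTop] (fun n : ℕ => (1.8863 : ℝ) ^ n) ∧
      ∀ (α : Type*) (H : Hypergraph α), H.vertexSet.Finite → H.rank ≤ 4 →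
        TransversalEnumeration.EnumeratesWithin p H (T H.vertexSet.ncard)) ∧
    (∃ N : ℕ → ℕ,
      (fun n : ℕ => (N n : ℝ)) =O[atTop] (fun n : ℕ => (1.8863 : ℝ) ^ n) ∧
      ∀ (α : Type*) (H : Hypergraph α), H.vertexSet.Finite → H.rank ≤ 4 →
        {S : Set α | H.IsMinimalTransversal S}.Finite ∧
        {S : Set α | H.IsMinimalTransversal S}.ncard ≤ N H.vertexSet.ncard) := by
  refine ⟨TransversalEnumeration.exists_enumeration, ?_⟩
  -- The time bound serves as the counting bound: run the program on any listing of the finitely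
  -- many vertices and hyperedges and count its outputs.
  obtain ⟨p, T, hT, hp⟩ := TransversalEnumeration.exists_enumeration
  refine ⟨T, hT, fun α H hfin hrank => ?_⟩
  have hlists {β : Type _} {A : Set β} (hA : A.Finite) :
      TransversalEnumeration.Lists hA.toFinset.toList A :=
    ⟨Finset.nodup_toList _, fun x => by simp⟩
  have hE : H.edgeSet.Finite :=
    hfin.powerset.subset fun e he => H.subset_vertexSet_of_mem_edgeSet' he
  obtain ⟨out, t, hout, ht, s, hexec⟩ := hp α H hfin hrank _ _ (hlists hfin) (hlists hE)
  have hset : {S : Set α | H.IsMinimalTransversal S} = {S | S ∈ out} := by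
    ext S; exact (hout.2 S).symm
  refine ⟨hset ▸ out.finite_toSet, ?_⟩
  rw [← hout.length_eq_ncard]
  have := hexec.length_le
  rw [List.length_map] at this
  exact this.trans ht
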